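/- Let $D\subset\mathbb{C}^n$ be a bounded domain (a bounded non-empty connected open set) and let $A\subset\partial D$ be compact. Let $\operatorname{PSH}(D)^-$ be the family of plurisubharmonic functions $u:D\to[-\infty,0]$ (the function $u\equiv-\infty$ being admitted), and put $u^*(\zeta)=\limsup_{z\to\zeta,\,z\in D}u(z)$ for $\zeta\in\overline D$. For $z\in D$ define \[\omega(z,A,D)=\sup\{u(z): u\in\operatorname{PSH}(D)^-,\ u^*\le-1 \text{ on } A\},\] \[\omega^c(z,A,D)=\sup\{u(z): u\in\operatorname{PSH}(D)^-\cap C(\overline D),\ u\le-1 \text{ on } A\},\] where $C(\overline D)$ denotes the real-valued continuous functions on $\overline D$. Assume that at least one of the following holds: (a) $D$ is B-regular, i.e. every continuous function $f:\partial D\to\mathbb{R}$ extends to a continuous function on $\overline D$ that is plurisubharmonic in $D$; (b) $D$ is strongly star shaped with respect to the origin, i.e. $r\overline D\subset D$ for all $0<r<1$; (c) $D$ is a polydisc, i.e. a product of $n$ open discs of arbitrary centres and positive finite radii. Then $\omega(z,A,D)=\omega^c(z,A,D)$ for every $z\in D$. -/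

import Mathlib

open Set Filter Topology MeasureTheory

noncomputable section

namespace PluriExtremal

/-- The integral of an extended-real function with respect to a measure: the integral of the
positive part minus that of the negative part.  It is a genuine element of `[-∞, ∞)` as soon as
the positive part has finite integral, which is always so in its only use below, because an upper
semicontinuous function without the value `+∞` is bounded above on a circle. -/
def eintegral {X : Type*} [MeasurableSpace X] (μ : Measure X) (f : X → EReal) : EReal :=
  ((∫⁻ x, (f x).toENNReal ∂μ : ENNReal) : EReal) - ((∫⁻ x, (-f x).toENNReal ∂μ : ENNReal) : EReal)

/-- The normalized arc length `dθ / 2π` on `(0, 2π]`. -/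
def arcMeasure : Measure ℝ :=
  ENNReal.ofReal (2 * Real.pi)⁻¹ • volume.restrict (Ioc 0 (2 * Real.pi))

/-- `u` is plurisubharmonic on the open set `D ⊆ ℂⁿ`: it takes values in `[-∞, ∞)`, is upper
semicontinuous, and satisfies the sub-mean value inequality on each closed disc (in a complex
line) contained in `D`.  The function that is identically `-∞` is admitted.  The values of `u`
outside `D` play no role. -/
structure IsPSH {n : ℕ} (D : Set (Fin n → ℂ)) (u : (Fin n → ℂ) → EReal) : Prop where
  lt_top : ∀ z ∈ D, u z < ⊤
  usc : UpperSemicontinuousOn u D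
  submean : ∀ a b : Fin n → ℂ, (∀ w : ℂ, ‖w‖ ≤ 1 → a + w • b ∈ D) →
    u a ≤ eintegral arcMeasure (fun θ : ℝ => u (a + Complex.exp (θ * Complex.I) • b))

/-- `u* (ζ) = limsup u(z)` as `z → ζ`, `z ∈ D`. -/
def upperReg {n : ℕ} (D : Set (Fin n → ℂ)) (u : (Fin n → ℂ) → EReal) (ζ : Fin n → ℂ) : EReal :=
  limsup u (𝓝[D] ζ)

/-- The boundary relative extremal function `ω(z, A, D)`. -/
def omega {n : ℕ} (z : Fin n → ℂ) (A D : Set (Fin n → ℂ)) : EReal :=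
  sSup {t | ∃ u : (Fin n → ℂ) → EReal, IsPSH D u ∧ (∀ w ∈ D, u w ≤ 0) ∧
    (∀ ζ ∈ A, upperReg D u ζ ≤ -1) ∧ t = u z}

/-- The boundary relative extremal function `ωᶜ(z, A, D)`, formed with the non-positive
plurisubharmonic functions on `D` that are (real-valued and) continuous on the closure of `D`. -/
def omegaC {n : ℕ} (z : Fin n → ℂ) (A D : Set (Fin n → ℂ)) : EReal :=
  sSup {t | ∃ u : (Fin n → ℂ) → ℝ, IsPSH D (fun w => (u w : EReal)) ∧ (∀ w ∈ D, u w ≤ 0) ∧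
    ContinuousOn u (closure D) ∧ (∀ ζ ∈ A, u ζ ≤ -1) ∧ t = (u z : EReal)}

/-- B-regularity: every real continuous function on the boundary extends to a function that is
continuous on the closure and plurisubharmonic inside. -/
def IsBRegular {n : ℕ} (D : Set (Fin n → ℂ)) : Prop :=
  ∀ f : (Fin n → ℂ) → ℝ, ContinuousOn f (frontier D) →
    ∃ u : (Fin n → ℂ) → ℝ, ContinuousOn u (closure D) ∧ IsPSH D (fun z => (u z : EReal)) ∧
      EqOn u f (frontier D)

/-- `D` is strongly star shaped with respect to the origin. -/
def IsStronglyStarShaped {n : ℕ} (D : Set (Fin n → ℂ)) : Prop :=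
  ∀ r : ℝ, 0 < r → r < 1 → ∀ z ∈ closure D, r • z ∈ D

/-- `D` is a polydisc: a product of `n` open discs of arbitrary centres and radii. -/
def IsPolydisc {n : ℕ} (D : Set (Fin n → ℂ)) : Prop :=
  ∃ (c : Fin n → ℂ) (r : Fin n → ℝ), (∀ i, 0 < r i) ∧ D = {z | ∀ i, ‖z i - c i‖ < r i}

end PluriExtremal

end

/-! The inequality `omegaC ≤ omega` is immediate, because a continuous competitor has its own values
as boundary limits. For the converse, a competitor u may be replaced by the bounded function v =
max(u, -1). Compactness of A gives v ≤ -1 + ε at all points of D within some distance τ of A. It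
then suffices to find, for each fixed z, a continuous competitor w with w(z) ≥ v(z) - 2ε
(`omega_le_omegaC_of_approx`).

If D is B-regular, w is an envelope lowered by ε (`IsBRegular.exists_continuous_approx`). The
boundary function φ = min(0, -1 + ε + dist(·, A)/τ) dominates the boundary values of v. Extensions U
of φ and W of -φ yield a continuous obstacle G = min(-W, 0) with boundary values φ, and the maximum
principle puts both U and v below G. The upper envelope of the minorants of G lies between U and G,
which agree on the boundary, so Walsh's translation argument (`envelope_translate_le`) makes it
continuous on the closure; it is plurisubharmonic and at least v.

If D is strongly star shaped about some c, as a polydisc is about its centre, w is obtained by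
convolving v and composing with a slight contraction T towards c. Since T maps the closure of D to a
compact subset of D, there is room to convolve. Convolution does not lower v at T z, so it remains
to have v(T z) > v(z) - ε. Upper semicontinuity points the wrong way here; what is needed is that a
ray is not thin at its end point (`IsLocPSH.frequently_lt_ray`), proved with a square root barrier.

All of this rests on a maximum principle that uses only small circles
(`IsLocPSH.nonpos_of_frontier`). The local notion permits gluing, and the maximum principle recovers
the inequality on all discs. -/

namespace PluriExtremal

/-! ### Local plurisubharmonicity and the maximum principle -/

open Real Metric

variable {E : Type*} [NormedAddCommGroup E] [NormedSpace ℂ E]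

/-- Bounded upper semicontinuous real functions that satisfy the sub-mean value inequality on all
sufficiently small circles in complex lines around each point of `Ω`. -/
structure IsLocPSH (Ω : Set E) (v : E → ℝ) : Prop where
  bdd : ∃ C, ∀ z ∈ Ω, |v z| ≤ C
  usc : UpperSemicontinuousOn v Ω
  submean : ∀ a ∈ Ω, ∀ b : E, ∀ᶠ r : ℝ in 𝓝[>] 0,
    v a ≤ circleAverage (fun w : ℂ => v (a + w • b)) 0 r

/-- The sub-mean value inequality on all closed discs in complex lines that lie in `Ω`. -/
def SubmeanOn (Ω : Set E) (v : E → ℝ) : Prop :=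
  ∀ a b : E, (∀ w : ℂ, ‖w‖ ≤ 1 → a + w • b ∈ Ω) →
    v a ≤ circleAverage (fun w : ℂ => v (a + w • b)) 0 1

theorem circleIntegrable_slice {Ω : Set E} {v : E → ℝ} (hb : ∃ C, ∀ z ∈ Ω, |v z| ≤ C)
    (hu : UpperSemicontinuousOn v Ω) {a b : E} {r : ℝ}
    (h : ∀ w ∈ sphere (0 : ℂ) |r|, a + w • b ∈ Ω) :
    CircleIntegrable (fun w : ℂ => v (a + w • b)) 0 r := by
  obtain ⟨C, hC⟩ := hb
  have hmem : ∀ θ : ℝ, a + circleMap 0 r θ • b ∈ Ω := fun θ => h _ (circleMap_mem_sphere' 0 r θ)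
  have husc : UpperSemicontinuous (fun θ : ℝ => v (a + circleMap 0 r θ • b)) := by
    intro θ y hy
    have hc : Tendsto (fun θ : ℝ => a + circleMap 0 r θ • b) (𝓝 θ)
        (𝓝[Ω] (a + circleMap 0 r θ • b)) := by
      refine tendsto_nhdsWithin_iff.2 ⟨?_, Eventually.of_forall hmem⟩
      have : Continuous (fun θ : ℝ => a + circleMap 0 r θ • b) := by
        have := continuous_circleMap 0 r
        fun_prop
      exact this.continuousAt
    exact hc.eventually (hu _ (hmem θ) y hy)
  unfold CircleIntegrable
  rw [intervalIntegrable_iff]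
  refine Measure.integrableOn_of_bounded (M := C) (by simp [ENNReal.mul_eq_top]) husc.measurable.aestronglyMeasurable ?_
  exact Eventually.of_forall fun θ => hC _ (hmem θ)

theorem eventually_disc_subset {Ω : Set E} (hΩ : IsOpen Ω) {a : E} (ha : a ∈ Ω) (b : E) :
    ∀ᶠ r : ℝ in 𝓝[>] 0, ∀ w : ℂ, ‖w‖ ≤ r → a + w • b ∈ Ω := by
  have hc : Continuous (fun w : ℂ => a + w • b) := by fun_prop
  have : (fun w : ℂ => a + w • b) ⁻¹' Ω ∈ 𝓝 (0 : ℂ) :=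
    hc.continuousAt.preimage_mem_nhds (hΩ.mem_nhds (by simpa using ha))
  obtain ⟨ε, hε, hs⟩ := Metric.mem_nhds_iff.1 this
  filter_upwards [Ioo_mem_nhdsGT hε] with r hr w hw
  exact hs (by simpa using hw.trans_lt hr.2)

theorem eventually_circleIntegrable {Ω : Set E} (hΩ : IsOpen Ω) {v : E → ℝ}
    (hb : ∃ C, ∀ z ∈ Ω, |v z| ≤ C) (hu : UpperSemicontinuousOn v Ω) {a : E} (ha : a ∈ Ω) (b : E) :
    ∀ᶠ r : ℝ in 𝓝[>] 0, CircleIntegrable (fun w : ℂ => v (a + w • b)) 0 r := by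
  filter_upwards [eventually_disc_subset hΩ ha b, self_mem_nhdsWithin] with r hr hr0
  refine circleIntegrable_slice hb hu fun w hw => hr w ?_
  rw [abs_of_pos hr0] at hw
  simpa using hw.le

/-- A function that is upper semicontinuous on a bounded open set and strictly below `c` near the
boundary has compact superlevel sets. -/
theorem isCompact_superlevel {X : Type*} [PseudoMetricSpace X] [ProperSpace X] {Ω : Set X} (hΩ : IsOpen Ω)
    (hbd : Bornology.IsBounded Ω) {v : X → ℝ} (hu : UpperSemicontinuousOn v Ω) {c : ℝ}
    (hfr : ∀ ζ ∈ frontier Ω, ∀ᶠ z in 𝓝[Ω] ζ, v z < c) :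
    IsCompact {z ∈ Ω | c ≤ v z} := by
  refine Metric.isCompact_of_isClosed_isBounded ?_ (hbd.subset fun z hz => hz.1)
  refine isClosed_of_closure_subset fun z hz => ?_
  have hzc : z ∈ closure Ω := closure_mono (fun z hz => hz.1) hz
  have hfreq : ∃ᶠ y in 𝓝 z, y ∈ Ω ∧ c ≤ v y := mem_closure_iff_frequently.1 hz
  have key : ¬ ∀ᶠ y in 𝓝[Ω] z, v y < c := fun h => by
    rw [eventually_nhdsWithin_iff] at h
    obtain ⟨y, hy, hy'⟩ := (hfreq.and_eventually h).exists
    exact absurd (hy' hy.1) (not_lt.2 hy.2)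
  by_cases hzΩ : z ∈ Ω
  · refine ⟨hzΩ, ?_⟩
    by_contra hlt
    exact key (hu z hzΩ c (not_le.1 hlt))
  · exact absurd (hfr z ⟨hzc, by rwa [hΩ.interior_eq]⟩) key

/-- The maximum principle. -/
theorem IsLocPSH.nonpos_of_frontier [ProperSpace E] [Nontrivial E] {Ω : Set E} (hΩ : IsOpen Ω)
    (hbd : Bornology.IsBounded Ω) {v : E → ℝ} (hv : IsLocPSH Ω v)
    (hfr : ∀ ζ ∈ frontier Ω, ∀ ε > 0, ∀ᶠ z in 𝓝[Ω] ζ, v z < ε) : ∀ z ∈ Ω, v z ≤ 0 := by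
  intro z₀ hz₀
  by_contra! hpos
  have hK := isCompact_superlevel hΩ hbd hv.usc (fun ζ hζ => hfr ζ hζ _ hpos)
  obtain ⟨z₁, hz₁, hmax⟩ := UpperSemicontinuousOn.exists_isMaxOn
    (s := {z ∈ Ω | v z₀ ≤ v z}) ⟨z₀, hz₀, le_rfl⟩ hK
    (hv.usc.mono fun z hz => hz.1)
  have hM : ∀ z ∈ Ω, v z ≤ v z₁ := fun z hz => by
    by_cases h : v z₀ ≤ v z
    · exact hmax (show z ∈ {z ∈ Ω | v z₀ ≤ v z} from ⟨hz, h⟩)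
    · exact (not_le.1 h).le.trans hz₁.2
  have hK' := isCompact_superlevel hΩ hbd hv.usc (c := v z₁)
    (fun ζ hζ => hfr ζ hζ _ (hpos.trans_le hz₁.2))
  obtain ⟨e, he⟩ := exists_ne (0 : E)
  obtain ⟨ℓ, -, hℓ⟩ := exists_dual_vector ℂ e (norm_ne_zero_iff.2 he)
  -- Among the points where `v` is maximal, `p` is extreme in the direction of `e`. A circle about
  -- `p` then leaves the maximum set along a whole arc, so no connectedness of `Ω` is needed.
  obtain ⟨p, hp, hpmax⟩ := hK'.exists_isMaxOn ⟨z₁, hz₁.1, le_rfl⟩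
    (f := fun z => (ℓ z).re) (by fun_prop)
  have hvp : v p = v z₁ := le_antisymm (hM p hp.1) hp.2
  have hne : ‖e‖ ≠ 0 := norm_ne_zero_iff.2 he
  obtain ⟨r, hr, hd, hi, hr0⟩ := ((hv.submean p hp.1 e).and
    ((eventually_disc_subset hΩ hp.1 e).and ((eventually_circleIntegrable hΩ hv.bdd hv.usc hp.1 e).and
      self_mem_nhdsWithin))).exists
  replace hr0 : 0 < r := hr0
  have hmem : ∀ θ : ℝ, p + circleMap 0 r θ • e ∈ Ω := fun θ => hd _ (by simp [abs_of_pos hr0])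
  have hlt : circleAverage (fun w : ℂ => v (p + w • e)) 0 r < v z₁ := by
    rw [← Real.circleAverage_const (v z₁) 0 r, circleAverage, circleAverage, smul_eq_mul, smul_eq_mul]
    refine mul_lt_mul_of_pos_left ?_ (by positivity)
    refine intervalIntegral.integral_lt_integral_of_ae_le_of_measure_setOfPred_lt_ne_zero
      two_pi_pos.le hi (by simp) (Eventually.of_forall fun θ => hM _ (hmem θ)) ?_
    -- On this arc Re ℓ exceeds its value at `p`, since `ℓ e = ‖e‖` and the cosine is positive.
    have hsub : Ioo 0 (π / 2) ⊆ {θ : ℝ | v (p + circleMap 0 r θ • e) < v z₁} := by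
      intro θ hθ
      by_contra hnot
      have h1 := hpmax (show p + circleMap 0 r θ • e ∈ _ from ⟨hmem θ, not_lt.1 hnot⟩)
      have hcos : 0 < cos θ := cos_pos_of_mem_Ioo ⟨by linarith [hθ.1, pi_pos], hθ.2⟩
      have h2 : (circleMap 0 r θ * (‖e‖ : ℂ)).re = r * cos θ * ‖e‖ := by
        simp [circleMap, Complex.exp_ofReal_mul_I_re, Complex.exp_ofReal_mul_I_im]
      simp only [map_add, map_smul, hℓ, smul_eq_mul, Complex.add_re, mem_ofPred_eq] at h1
      have h3 : (circleMap 0 r θ * (‖e‖ : ℂ)).re ≤ 0 := by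
        have := h1
        simp only [RCLike.ofReal_eq_complex_ofReal] at this ⊢
        linarith
      rw [h2] at h3
      have : 0 < r * cos θ * ‖e‖ := by positivity
      linarith
    intro h0
    have h1 := measure_mono_null hsub h0
    rw [Measure.restrict_apply measurableSet_Ioo, inter_eq_left.2] at h1
    · simp at h1
      linarith [pi_pos]
    · intro θ hθ
      exact ⟨hθ.1, by linarith [hθ.2, pi_pos]⟩
  exact absurd (hr.trans_lt hlt) (by rw [hvp]; exact lt_irrefl _)

end PluriExtremal

/-! ### Stability properties and real parts of holomorphic functions -/

namespace PluriExtremal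

open Real Metric

variable {E : Type*} [NormedAddCommGroup E] [NormedSpace ℂ E]

theorem IsLocPSH.mono {Ω Ω' : Set E} {v : E → ℝ} (hv : IsLocPSH Ω v) (h : Ω' ⊆ Ω) :
    IsLocPSH Ω' v where
  bdd := hv.bdd.imp fun _ hC z hz => hC z (h hz)
  usc := hv.usc.mono h
  submean a ha b := hv.submean a (h ha) b

theorem isLocPSH_const (Ω : Set E) (c : ℝ) : IsLocPSH Ω (fun _ => c) where
  bdd := ⟨|c|, fun _ _ => le_rfl⟩
  usc := continuousOn_const.upperSemicontinuousOn
  submean a ha b := by simp [circleAverage_const]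

theorem IsLocPSH.add {Ω : Set E} (hΩ : IsOpen Ω) {u v : E → ℝ} (hu : IsLocPSH Ω u)
    (hv : IsLocPSH Ω v) : IsLocPSH Ω (fun z => u z + v z) where
  bdd := by
    obtain ⟨C, hC⟩ := hu.bdd
    obtain ⟨C', hC'⟩ := hv.bdd
    exact ⟨C + C', fun z hz => (abs_add_le _ _).trans (add_le_add (hC z hz) (hC' z hz))⟩
  usc := hu.usc.add hv.usc
  submean a ha b := by
    filter_upwards [hu.submean a ha b, hv.submean a ha b,
      eventually_circleIntegrable hΩ hu.bdd hu.usc ha b,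
      eventually_circleIntegrable hΩ hv.bdd hv.usc ha b] with r h1 h2 h3 h4
    rw [circleAverage_fun_add h3 h4]
    exact add_le_add h1 h2

theorem IsLocPSH.max {Ω : Set E} (hΩ : IsOpen Ω) {u v : E → ℝ} (hu : IsLocPSH Ω u)
    (hv : IsLocPSH Ω v) : IsLocPSH Ω (fun z => max (u z) (v z)) := by
  have hbdd : ∃ C, ∀ z ∈ Ω, |Max.max (u z) (v z)| ≤ C := by
    obtain ⟨C, hC⟩ := hu.bdd
    obtain ⟨C', hC'⟩ := hv.bdd
    refine ⟨Max.max C C', fun z hz => abs_max_le_max_abs_abs.trans (max_le_max (hC z hz) (hC' z hz))⟩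
  have husc : UpperSemicontinuousOn (fun z => Max.max (u z) (v z)) Ω := hu.usc.sup hv.usc
  refine ⟨hbdd, husc, fun a ha b => ?_⟩
  filter_upwards [hu.submean a ha b, hv.submean a ha b,
    eventually_circleIntegrable hΩ hu.bdd hu.usc ha b,
    eventually_circleIntegrable hΩ hv.bdd hv.usc ha b,
    eventually_circleIntegrable hΩ hbdd husc ha b] with r h1 h2 h3 h4 h5
  exact max_le (h1.trans (circleAverage_mono h3 h5 fun _ _ => le_max_left _ _))
    (h2.trans (circleAverage_mono h4 h5 fun _ _ => le_max_right _ _))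

theorem IsLocPSH.comp_line {Ω : Set E} {v : E → ℝ} (hv : IsLocPSH Ω v) (a b : E) :
    IsLocPSH ((fun w : ℂ => a + w • b) ⁻¹' Ω) (fun w : ℂ => v (a + w • b)) where
  bdd := hv.bdd.imp fun _ hC w hw => hC _ hw
  usc := by
    intro w hw y hy
    have hc : Tendsto (fun w : ℂ => a + w • b) (𝓝[(fun w : ℂ => a + w • b) ⁻¹' Ω] w)
        (𝓝[Ω] (a + w • b)) := by
      refine tendsto_nhdsWithin_iff.2 ⟨?_, self_mem_nhdsWithin⟩
      have : Continuous (fun w : ℂ => a + w • b) := by fun_prop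
      exact this.continuousWithinAt
    exact hc.eventually (hv.usc _ hw y hy)
  submean w hw c := by
    filter_upwards [hv.submean _ hw (c • b)] with r hr
    simpa only [add_smul, smul_assoc, add_assoc] using hr

theorem IsLocPSH.comp_add {Ω : Set E} {v : E → ℝ} (hv : IsLocPSH Ω v) (h : E) :
    IsLocPSH ((fun z => z + h) ⁻¹' Ω) (fun z => v (z + h)) where
  bdd := hv.bdd.imp fun _ hC z hz => hC _ hz
  usc := by
    intro z hz y hy
    have hc : Tendsto (fun z : E => z + h) (𝓝[(fun z => z + h) ⁻¹' Ω] z) (𝓝[Ω] (z + h)) := by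
      refine tendsto_nhdsWithin_iff.2 ⟨?_, self_mem_nhdsWithin⟩
      exact (continuous_add_const h).continuousWithinAt
    exact hc.eventually (hv.usc _ hz y hy)
  submean z hz b := by
    filter_upwards [hv.submean _ hz b] with r hr
    simpa only [add_right_comm] using hr

/-- Only small circles are tested, so everything but boundedness is local. This is what makes the
gluing of competitors possible. -/
theorem isLocPSH_of_locally {Ω : Set E} {v : E → ℝ} (hb : ∃ C, ∀ z ∈ Ω, |v z| ≤ C)
    (h : ∀ z ∈ Ω, ∃ N : Set E, IsOpen N ∧ z ∈ N ∧ ∃ g : E → ℝ, IsLocPSH N g ∧ EqOn v g N) :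
    IsLocPSH Ω v where
  bdd := hb
  usc := by
    intro z hz
    obtain ⟨N, hN, hzN, g, hg, he⟩ := h z hz
    have h1 : UpperSemicontinuousAt v z := by
      intro y hy
      have h2 := hg.usc z hzN y (by simpa only [he hzN] using hy)
      rw [hN.nhdsWithin_eq hzN] at h2
      filter_upwards [h2, hN.mem_nhds hzN] with x hx hxN
      rw [he hxN]
      exact hx
    exact h1.upperSemicontinuousWithinAt Ω
  submean a ha b := by
    obtain ⟨N, hN, hzN, g, hg, he⟩ := h a ha
    filter_upwards [hg.submean a hzN b, eventually_disc_subset hN hzN b, self_mem_nhdsWithin]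
      with r hr hd hr0
    rw [he hzN]
    refine hr.trans_eq (circleAverage_congr_sphere fun w hw => ?_)
    rw [abs_of_pos hr0] at hw
    exact (he (hd w (by simpa using hw.le))).symm

theorem circleAverage_slice (v : E → ℝ) (a b : E) (r : ℝ) :
    circleAverage (fun w : ℂ => v (a + w • b)) 0 r =
      circleAverage (fun w : ℂ => v (a + w • ((r : ℂ) • b))) 0 1 := by
  rw [circleAverage_eq_circleAverage_zero_one]
  simp only [add_zero, smul_smul, mul_comm]

theorem SubmeanOn.isLocPSH {Ω : Set E} (hΩ : IsOpen Ω) {v : E → ℝ} (hv : SubmeanOn Ω v)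
    (hb : ∃ C, ∀ z ∈ Ω, |v z| ≤ C) (hu : UpperSemicontinuousOn v Ω) : IsLocPSH Ω v where
  bdd := hb
  usc := hu
  submean a ha b := by
    filter_upwards [eventually_disc_subset hΩ ha b, self_mem_nhdsWithin] with r hr hr0
    rw [circleAverage_slice]
    refine hv _ _ fun w hw => ?_
    rw [smul_smul]
    refine hr _ ?_
    rw [norm_mul, Complex.norm_real, norm_of_nonneg (le_of_lt hr0)]
    exact mul_le_of_le_one_left (le_of_lt hr0) hw

theorem circleAverage_re_of_differentiableOn {g : ℂ → ℂ} {c : ℂ} {r : ℝ} (hr : 0 ≤ r)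
    {Ω : Set ℂ} (hg : DifferentiableOn ℂ g Ω) (h : closedBall c r ⊆ Ω) :
    circleAverage (fun w => (g w).re) c r = (g c).re := by
  have hd : DiffContOnCl ℂ g (ball c |r|) := by
    rw [abs_of_nonneg hr]
    exact (hg.mono h).diffContOnCl_ball le_rfl
  rw [← hd.circleAverage]
  refine Complex.reCLM.circleAverage_comp_comm (f := g) ?_
  exact (hg.continuousOn.mono (sphere_subset_closedBall.trans h)).circleIntegrable hr

/-- The mean value property holds with equality. Such functions serve as harmonic majorants on discs
and as the barrier on a slit disc. -/
theorem isLocPSH_re {g : ℂ → ℂ} {Ω : Set ℂ} (hΩ : IsOpen Ω) (hg : DifferentiableOn ℂ g Ω)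
    (hb : ∃ C, ∀ z ∈ Ω, ‖g z‖ ≤ C) : IsLocPSH Ω (fun w => (g w).re) where
  bdd := hb.imp fun _ hC z hz => (Complex.abs_re_le_norm _).trans (hC z hz)
  usc := (Complex.continuous_re.comp_continuousOn hg.continuousOn).upperSemicontinuousOn
  submean a ha b := by
    filter_upwards [eventually_disc_subset hΩ ha b, self_mem_nhdsWithin] with r hr hr0
    rw [circleAverage_re_of_differentiableOn (g := fun w => g (a + w • b)) (c := 0) (r := r)
      (le_of_lt hr0) (Ω := (fun w : ℂ => a + w • b) ⁻¹' Ω)]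
    · simp
    · exact hg.comp (by fun_prop) fun w hw => hw
    · exact fun w hw => hr w (by simpa using hw)

end PluriExtremal

/-! ### From small circles to all discs, by harmonic majorants -/

namespace PluriExtremal

open Real Metric

variable {E : Type*} [NormedAddCommGroup E] [NormedSpace ℂ E]

/-- On the unit circle a character of non-negative degree m is w ^ m, and one of degree -m is the
conjugate of w ^ m. -/
theorem exists_entire_of_mem_span_fourier {T : C(AddCircle (2 * π), ℂ)}
    (hT : T ∈ Submodule.span ℂ (range <| @fourier (2 * π))) :
    ∃ p q : ℂ → ℂ, Differentiable ℂ p ∧ Differentiable ℂ q ∧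
      ∀ θ : ℝ, T θ = p (circleMap 0 1 θ) + (starRingEnd ℂ) (q (circleMap 0 1 θ)) := by
  have hexp : ∀ (n : ℕ) (θ : ℝ), circleMap 0 1 θ ^ n = Complex.exp (n * θ * Complex.I) := by
    intro n θ
    simp [circleMap_zero, ← Complex.exp_nat_mul, mul_assoc]
  induction hT using Submodule.span_induction with
  | mem x hx =>
    obtain ⟨n, rfl⟩ := hx
    have hf : ∀ θ : ℝ, fourier n (θ : AddCircle (2 * π)) = Complex.exp (n * θ * Complex.I) := by
      intro θ
      rw [fourier_coe_apply]
      congr 1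
      have : (π : ℂ) ≠ 0 := by exact_mod_cast pi_ne_zero
      push_cast
      field_simp
    obtain ⟨m, rfl | rfl⟩ := n.eq_nat_or_neg
    · refine ⟨fun w => w ^ m, 0, by fun_prop, by fun_prop, fun θ => ?_⟩
      simp [hf, hexp]
    · refine ⟨0, fun w => w ^ m, by fun_prop, by fun_prop, fun θ => ?_⟩
      simp [hf, hexp, ← Complex.exp_conj]
  | zero => exact ⟨0, 0, by fun_prop, by fun_prop, fun θ => by simp⟩
  | add x y _ _ hx hy =>
    obtain ⟨p, q, hp, hq, h⟩ := hx
    obtain ⟨p', q', hp', hq', h'⟩ := hy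
    refine ⟨p + p', q + q', hp.add hp', hq.add hq', fun θ => ?_⟩
    simp only [ContinuousMap.add_apply, h, h', Pi.add_apply, map_add]
    ring
  | smul c x _ hx =>
    obtain ⟨p, q, hp, hq, h⟩ := hx
    refine ⟨c • p, (starRingEnd ℂ c) • q, hp.const_smul _, hq.const_smul _, fun θ => ?_⟩
    simp only [ContinuousMap.smul_apply, h, Pi.smul_apply, smul_eq_mul, map_mul, Complex.conj_conj]
    ring

/-- Continuous functions on the circle are uniform limits of real parts of entire functions. -/
theorem exists_entire_re_near {g : ℂ → ℝ} (hg : ContinuousOn g (sphere 0 1)) {ε : ℝ} (hε : 0 < ε) :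
    ∃ p : ℂ → ℂ, Differentiable ℂ p ∧ ∀ w ∈ sphere (0 : ℂ) 1, |g w - (p w).re| < ε := by
  have : Fact (0 < 2 * π) := ⟨two_pi_pos⟩
  let F : C(AddCircle (2 * π), ℂ) :=
    ⟨fun t => (g (AddCircle.toCircle t : ℂ) : ℂ), by
      refine Complex.continuous_ofReal.comp (hg.comp_continuous ?_ fun t =>
        mem_sphere_zero_iff_norm.2 (Circle.norm_coe _))
      exact continuous_subtype_val.comp AddCircle.continuous_toCircle⟩
  have hF : F ∈ (Submodule.span ℂ (range <| @fourier (2 * π))).topologicalClosure := by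
    rw [span_fourier_closure_eq_top]
    trivial
  obtain ⟨T, hT, hd⟩ := Metric.mem_closure_iff.1 hF ε hε
  obtain ⟨p, q, hp, hq, h⟩ := exists_entire_of_mem_span_fourier hT
  refine ⟨fun w => p w + q w, hp.add hq, fun w hw => ?_⟩
  obtain ⟨θ, rfl⟩ : ∃ θ : ℝ, circleMap 0 1 θ = w := by
    have : w ∈ range (circleMap 0 1) := by rw [range_circleMap]; simpa using hw
    exact this
  have h1 : ‖(F - T) θ‖ < ε := (ContinuousMap.norm_coe_le_norm _ _).trans_lt (by
    rwa [← dist_eq_norm])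
  have h2 : ((AddCircle.toCircle (θ : AddCircle (2 * π)) : Circle) : ℂ) = circleMap 0 1 θ := by
    rw [AddCircle.toCircle_apply_mk]
    simp [circleMap, Circle.coe_exp]
  have h3 : g (circleMap 0 1 θ) - (p (circleMap 0 1 θ) + q (circleMap 0 1 θ)).re
      = ((F - T) (θ : AddCircle (2 * π))).re := by
    simp [F, h, h2]
  rw [h3]
  exact (Complex.abs_re_le_norm _).trans_lt h1

/-- An approximation of `g` within ε/2, raised by ε/2, is a majorant whose mean, its value at the
centre, exceeds that of `g` by at most ε. This replaces solving the Dirichlet problem with the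
Poisson integral. -/
theorem le_circleAverage_of_forall_entire {g : ℂ → ℝ} (hg : ContinuousOn g (sphere 0 1)) {c : ℝ}
    (h : ∀ p : ℂ → ℂ, Differentiable ℂ p → (∀ w ∈ sphere (0 : ℂ) 1, g w ≤ (p w).re) →
      c ≤ (p 0).re) : c ≤ circleAverage g 0 1 := by
  refine le_of_forall_pos_le_add fun ε hε => ?_
  obtain ⟨p, hp, hpg⟩ := exists_entire_re_near hg (half_pos hε)
  have h1 := h (fun w => p w + (ε / 2 : ℝ)) (hp.add_const _) fun w hw => by
    have := (abs_lt.1 (hpg w hw)).2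
    rw [Complex.add_re, Complex.ofReal_re]
    linarith
  rw [Complex.add_re, Complex.ofReal_re, ← circleAverage_re_of_differentiableOn zero_le_one
    hp.differentiableOn (subset_univ _)] at h1
  have hi : CircleIntegrable g 0 1 := hg.circleIntegrable zero_le_one
  have h2 : circleAverage (fun w => (p w).re) 0 1 ≤ circleAverage (fun w => g w + ε / 2) 0 1 := by
    refine circleAverage_mono ?_ (hi.add (circleIntegrable_const _ _ _)) fun w hw => ?_
    · exact (Complex.continuous_re.comp hp.continuous).continuousOn.circleIntegrable zero_le_one
    · rw [abs_one] at hw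
      have := (abs_lt.1 (hpg w hw)).1
      linarith
  rw [circleAverage_fun_add hi (circleIntegrable_const _ _ _), circleAverage_const] at h2
  linarith

/-- The maximum principle for v - Re p on the unit disc. Upper semicontinuity on the closed disc
turns the inequality on the circle into the required boundary behaviour. -/
theorem IsLocPSH.le_re_of_circle {D : Set E} {v : E → ℝ} (hv : IsLocPSH D v) {a b : E}
    (hd : ∀ w : ℂ, ‖w‖ ≤ 1 → a + w • b ∈ D) {p : ℂ → ℂ} (hp : Differentiable ℂ p)
    (h : ∀ w ∈ sphere (0 : ℂ) 1, v (a + w • b) ≤ (p w).re) : v a ≤ (p 0).re := by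
  have hpre : closedBall (0 : ℂ) 1 ⊆ (fun w : ℂ => a + w • b) ⁻¹' D :=
    fun w hw => hd w (by simpa using hw)
  have h1 : IsLocPSH (ball (0 : ℂ) 1) (fun w => v (a + w • b) + (-p w).re) := by
    refine ((hv.comp_line a b).mono (ball_subset_closedBall.trans hpre)).add isOpen_ball ?_
    refine isLocPSH_re isOpen_ball hp.neg.differentiableOn ?_
    obtain ⟨C, hC⟩ := (isCompact_closedBall (0 : ℂ) 1).exists_bound_of_continuousOn
      hp.neg.continuous.continuousOn
    exact ⟨C, fun z hz => hC z (ball_subset_closedBall hz)⟩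
  have h2 := h1.nonpos_of_frontier isOpen_ball isBounded_ball ?_ 0 (by simp)
  · simp only [zero_smul, add_zero, Complex.neg_re] at h2
    linarith
  · intro ζ hζ ε hε
    rw [frontier_ball _ one_ne_zero] at hζ
    have husc : UpperSemicontinuousOn (fun w => v (a + w • b) + (-p w).re) (closedBall 0 1) := by
      refine ((hv.comp_line a b).usc.mono hpre).add ?_
      exact (Complex.continuous_re.comp hp.neg.continuous).continuousOn.upperSemicontinuousOn
    refine nhdsWithin_mono _ ball_subset_closedBall
      (husc ζ (sphere_subset_closedBall hζ) ε ?_)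
    have := h ζ hζ
    simp only [Complex.neg_re]
    linarith

end PluriExtremal

/-! ### The envelope below a continuous obstacle -/

namespace PluriExtremal

open Real Metric

variable {E : Type*} [NormedAddCommGroup E] [NormedSpace ℂ E]

open Classical in
/-- The translate of `v` lowered by `ε`, glued with `U` where the translate is not defined. -/
theorem IsLocPSH.glue_translate {D : Set E} (hD : IsOpen D) {U G v : E → ℝ}
    (hU : IsLocPSH D U) (hv : IsLocPSH D v) (hvG : ∀ z ∈ D, v z ≤ G z) {h : E} {ε : ℝ}
    (hnear : ∀ z ∈ D, z + h ∉ D → ∀ᶠ y in 𝓝 z, y + h ∈ D → G (y + h) - ε ≤ U y) :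
    IsLocPSH D (fun z => if z + h ∈ D then Max.max (v (z + h) - ε) (U z) else U z) := by
  refine isLocPSH_of_locally ?_ fun z hz => ?_
  · obtain ⟨C, hC⟩ := hU.bdd
    obtain ⟨C', hC'⟩ := hv.bdd
    refine ⟨C + C' + |ε|, fun z hz => ?_⟩
    have h1 := abs_le.1 (hC z hz)
    have h2 : 0 ≤ C' := (abs_nonneg _).trans (hC' z hz)
    have h3 := abs_nonneg ε
    have h4 := neg_abs_le ε
    split_ifs with hzh
    · have h5 := abs_le.1 (hC' _ hzh)
      rw [abs_le]
      constructor
      · exact le_trans (by linarith [h1.1]) (le_max_right _ _)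
      · exact max_le (by linarith [h5.2, h1.1, h1.2, neg_le_abs ε]) (by linarith [h1.2])
    · rw [abs_le]
      constructor <;> linarith [h1.1, h1.2]
  · by_cases hzh : z + h ∈ D
    · have hopen : IsOpen ((fun z => z + h) ⁻¹' D) := hD.preimage (by fun_prop)
      refine ⟨D ∩ (fun z => z + h) ⁻¹' D, hD.inter hopen, ⟨hz, hzh⟩,
        fun z => Max.max (v (z + h) + -ε) (U z), ?_, fun y hy => ?_⟩
      · refine IsLocPSH.max (hD.inter hopen) ?_ (hU.mono inter_subset_left)
        exact ((hv.comp_add h).mono inter_subset_right).add (hD.inter hopen) (isLocPSH_const _ _)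
      · have : y + h ∈ D := hy.2
        simp [this, sub_eq_add_neg]
    -- Close to a point whose translate has left `D`, the lowered translate lies below `U` wherever
    -- it is defined, so the glued function coincides with `U`.
    · obtain ⟨N, hN, hNo, hzN⟩ := _root_.eventually_nhds_iff.1 ((hnear z hz hzh).and (hD.mem_nhds hz))
      refine ⟨N, hNo, hzN, U, hU.mono fun y hy => (hN y hy).2, fun y hy => ?_⟩
      by_cases hyh : y + h ∈ D
      · have h1 := (hN y hy).1 hyh
        have h2 := hvG _ hyh
        simp only [hyh, if_true]
        exact max_eq_right (by linarith)
      · simp [hyh]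

theorem exists_mem_segment_frontier {D : Set E} (hD : IsOpen D) {z y : E} (hz : z ∈ D)
    (hy : y ∉ D) : ∃ ξ ∈ segment ℝ z y, ξ ∈ frontier D := by
  by_contra! hno
  have hc : ∀ ξ ∈ segment ℝ z y, ξ ∉ D → ξ ∉ closure D := fun ξ hξ hξD hξc =>
    hno ξ hξ ⟨hξc, by rwa [hD.interior_eq]⟩
  obtain ⟨ξ, -, h1, h2⟩ := (convex_segment (𝕜 := ℝ) z y).isPreconnected D (closure D)ᶜ hD
    isClosed_closure.isOpen_compl
    (fun ξ hξ => by
      by_cases h : ξ ∈ D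
      · exact Or.inl h
      · exact Or.inr (hc ξ hξ h))
    ⟨z, left_mem_segment ℝ _ _, hz⟩
    ⟨y, right_mem_segment ℝ _ _, hc y (right_mem_segment ℝ _ _) hy⟩
  exact h2 (subset_closure h1)

open Classical in
/-- The upper envelope of the locally plurisubharmonic minorants of `G` in `D`, continued by `G`. -/
noncomputable def envelope (D : Set E) (G : E → ℝ) (z : E) : ℝ :=
  if z ∈ D then sSup {t | ∃ v, IsLocPSH D v ∧ (∀ z ∈ D, v z ≤ G z) ∧ t = v z} else G z

theorem IsLocPSH.le_envelope {D : Set E} {G v : E → ℝ} (hv : IsLocPSH D v)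
    (hvG : ∀ z ∈ D, v z ≤ G z) {z : E} (hz : z ∈ D) : v z ≤ envelope D G z := by
  rw [envelope, if_pos hz]
  refine le_csSup ⟨G z, ?_⟩ ⟨v, hv, hvG, rfl⟩
  rintro t ⟨u, -, hu, rfl⟩
  exact hu z hz

theorem envelope_le {D : Set E} {G U : E → ℝ} (hU : IsLocPSH D U) (hUG : ∀ z ∈ D, U z ≤ G z)
    {z : E} (hz : z ∈ D) {c : ℝ}
    (h : ∀ v, IsLocPSH D v → (∀ z ∈ D, v z ≤ G z) → v z ≤ c) : envelope D G z ≤ c := by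
  rw [envelope, if_pos hz]
  refine csSup_le ⟨U z, U, hU, hUG, rfl⟩ ?_
  rintro t ⟨u, hu, huG, rfl⟩
  exact h u hu huG

/-- Walsh's argument: a minorant of `G`, translated by a small `h`, lowered by `ε` and glued with
`U`, is again a minorant of `G`. Uniform continuity of `U` and `G`, together with their agreement on
the boundary, makes the gluing legitimate. -/
theorem envelope_translate_le [ProperSpace E] {D : Set E} (hD : IsOpen D)
    (hbd : Bornology.IsBounded D) {U G : E → ℝ} (hUc : ContinuousOn U (closure D))
    (hGc : ContinuousOn G (closure D)) (hUG : ∀ z ∈ D, U z ≤ G z)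
    (heq : ∀ z ∈ frontier D, U z = G z) (hU : IsLocPSH D U) {ε : ℝ} (hε : 0 < ε) :
    ∃ δ > 0, ∀ z ∈ D, ∀ h : E, ‖h‖ < δ → z + h ∈ D → envelope D G (z + h) ≤ envelope D G z + ε := by
  classical
  have hcpt : IsCompact (closure D) := hbd.isCompact_closure
  obtain ⟨δ₁, hδ₁, hU1⟩ := Metric.uniformContinuousOn_iff.1
    (hcpt.uniformContinuousOn_of_continuous hUc) (ε / 2) (half_pos hε)
  obtain ⟨δ₂, hδ₂, hG1⟩ := Metric.uniformContinuousOn_iff.1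
    (hcpt.uniformContinuousOn_of_continuous hGc) (ε / 2) (half_pos hε)
  refine ⟨min δ₁ δ₂, lt_min hδ₁ hδ₂, fun z hz h hh hzh => ?_⟩
  have hnear : ∀ z ∈ D, z + h ∉ D → ∀ᶠ y in 𝓝 z, y + h ∈ D → G (y + h) - ε ≤ U y := by
    intro z hz hzh
    obtain ⟨ξ, hξ, hξf⟩ := exists_mem_segment_frontier hD hz hzh
    obtain ⟨t, ht, rfl⟩ : ∃ t ∈ Icc (0 : ℝ) 1, z + t • h = ξ := by
      rw [segment_eq_image'] at hξ
      simpa using hξ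
    -- The segment from `z` to `z + h` meets the boundary at `z + t • h`. For `y` this close to `z`,
    -- both `y` and `y + h` lie within `min δ₁ δ₂` of that point, where `U = G`.
    filter_upwards [hD.mem_nhds hz, Metric.ball_mem_nhds z (sub_pos.2 hh)] with y hyD hy hyh
    rw [mem_ball, dist_eq_norm] at hy
    have e1 : dist y (z + t • h) < min δ₁ δ₂ := by
      rw [dist_eq_norm, show y - (z + t • h) = (y - z) - t • h by abel]
      have := norm_sub_le (y - z) (t • h)
      rw [norm_smul, norm_of_nonneg ht.1] at this
      nlinarith [norm_nonneg h, ht.2]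
    have e2 : dist (y + h) (z + t • h) < min δ₁ δ₂ := by
      rw [dist_eq_norm, show y + h - (z + t • h) = (y - z) + (1 - t) • h by rw [sub_smul, one_smul]; abel]
      have := norm_add_le (y - z) ((1 - t) • h)
      rw [norm_smul, norm_of_nonneg (sub_nonneg.2 ht.2)] at this
      nlinarith [norm_nonneg h, ht.1]
    have e3 := hU1 y (subset_closure hyD) _ (frontier_subset_closure hξf) (e1.trans_le (min_le_left _ _))
    have e4 := hG1 _ (subset_closure hyh) _ (frontier_subset_closure hξf) (e2.trans_le (min_le_right _ _))
    rw [Real.dist_eq, abs_lt] at e3 e4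
    have := heq _ hξf
    linarith [e3.1, e4.2]
  refine envelope_le hU hUG hzh fun v hv hvG => ?_
  have hglue := hU.glue_translate hD hv hvG hnear
  have hle : ∀ z ∈ D, (if z + h ∈ D then Max.max (v (z + h) - ε) (U z) else U z) ≤ G z := by
    intro z hz
    split_ifs with hzh
    · refine max_le ?_ (hUG z hz)
      have h1 := hvG _ hzh
      have h2 := hG1 _ (subset_closure hzh) _ (subset_closure hz)
        (by simpa [dist_eq_norm] using hh.trans_le (min_le_right _ _))
      rw [Real.dist_eq, abs_lt] at h2
      linarith [h2.2]
    · exact hUG z hz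
  have h1 := hglue.le_envelope hle hz
  simp only [hzh, if_true] at h1
  linarith [le_max_left (v (z + h) - ε) (U z)]

/-- Inside, the translation estimate is applied with `h` and `-h`; at the boundary the envelope is
squeezed between `U` and `G`. -/
theorem continuousOn_envelope [ProperSpace E] {D : Set E} (hD : IsOpen D)
    (hbd : Bornology.IsBounded D) {U G : E → ℝ} (hUc : ContinuousOn U (closure D))
    (hGc : ContinuousOn G (closure D)) (hUG : ∀ z ∈ D, U z ≤ G z)
    (heq : ∀ z ∈ frontier D, U z = G z) (hU : IsLocPSH D U) :
    ContinuousOn (envelope D G) (closure D) := by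
  intro z hz
  by_cases hzD : z ∈ D
  · refine ContinuousAt.continuousWithinAt ?_
    rw [Metric.continuousAt_iff']
    intro ε hε
    obtain ⟨δ, hδ, h⟩ := envelope_translate_le hD hbd hUc hGc hUG heq hU (half_pos hε)
    filter_upwards [hD.mem_nhds hzD, ball_mem_nhds z hδ] with y hyD hy
    rw [mem_ball, dist_eq_norm] at hy
    have h1 := h z hzD (y - z) hy (by simpa using hyD)
    have h2 := h y hyD (z - y) (by rwa [norm_sub_rev]) (by simpa using hzD)
    rw [add_sub_cancel] at h1 h2
    rw [Real.dist_eq, abs_lt]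
    constructor <;> linarith
  · have hzf : z ∈ frontier D := ⟨hz, by rwa [hD.interior_eq]⟩
    have hVz : envelope D G z = G z := if_neg hzD
    have hU' := hUc z hz
    have hG' := hGc z hz
    unfold ContinuousWithinAt at *
    rw [heq z hzf] at hU'
    rw [hVz]
    refine tendsto_of_tendsto_of_tendsto_of_le_of_le' hU' hG' ?_ ?_
    · filter_upwards [self_mem_nhdsWithin] with y hy
      by_cases hyD : y ∈ D
      · exact hU.le_envelope hUG hyD
      · rw [envelope, if_neg hyD]
        exact (heq y ⟨hy, by rwa [hD.interior_eq]⟩).le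
    · filter_upwards [self_mem_nhdsWithin] with y hy
      by_cases hyD : y ∈ D
      · exact envelope_le hU hUG hyD fun v _ hv => hv y hyD
      · rw [envelope, if_neg hyD]

/-- A harmonic majorant of the envelope on a circle majorizes every competitor there, hence at the
centre, hence the supremum at the centre. Continuity spares the upper regularization. -/
theorem submeanOn_envelope {D : Set E} {U G : E → ℝ} (hc : ContinuousOn (envelope D G) D)
    (hUG : ∀ z ∈ D, U z ≤ G z) (hU : IsLocPSH D U) : SubmeanOn D (envelope D G) := by
  intro a b hd
  have ha : a ∈ D := by simpa using hd 0 (by simp)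
  refine le_circleAverage_of_forall_entire ?_ fun p hp h => ?_
  · refine hc.comp (by fun_prop) fun w hw => hd w ?_
    simpa using (mem_sphere_zero_iff_norm.1 hw).le
  · refine envelope_le hU hUG ha fun v hv hvG => ?_
    refine hv.le_re_of_circle hd hp fun w hw => (hv.le_envelope hvG ?_).trans (h w hw)
    exact hd w (mem_sphere_zero_iff_norm.1 hw).le

end PluriExtremal

/-! ### From extended-real functions to bounded real ones -/

namespace PluriExtremal

open Real Metric

theorem eintegral_mono {X : Type*} [MeasurableSpace X] (μ : Measure X) {f g : X → EReal}
    (h : ∀ x, f x ≤ g x) : eintegral μ f ≤ eintegral μ g := by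
  unfold eintegral
  refine EReal.sub_le_sub ?_ ?_
  · exact EReal.coe_ennreal_le_coe_ennreal_iff.2
      (lintegral_mono fun x => EReal.toENNReal_le_toENNReal (h x))
  · exact EReal.coe_ennreal_le_coe_ennreal_iff.2
      (lintegral_mono fun x => EReal.toENNReal_le_toENNReal (EReal.neg_le_neg_iff.2 (h x)))

theorem eintegral_coe {X : Type*} [MeasurableSpace X] {μ : Measure X} {f : X → ℝ}
    (hf : Integrable f μ) : eintegral μ (fun x => (f x : EReal)) = ((∫ x, f x ∂μ : ℝ) : EReal) := by
  have h1 : ∀ x : ℝ, ((x : EReal)).toENNReal = ENNReal.ofReal x := fun x => by simp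
  have h2 : ∀ {g : X → ℝ}, Integrable g μ → ∫⁻ x, ENNReal.ofReal (g x) ∂μ ≠ ⊤ := fun {g} hg =>
    ((lintegral_mono fun x => ofReal_le_enorm (g x)).trans_lt hg.2).ne
  unfold eintegral
  rw [integral_eq_lintegral_pos_part_sub_lintegral_neg_part hf, EReal.coe_sub]
  simp only [← EReal.coe_neg, h1]
  rw [EReal.coe_ennreal_toReal (h2 hf), EReal.coe_ennreal_toReal (h2 (g := fun x => -f x) hf.neg)]

theorem eintegral_arcMeasure_coe {g : ℂ → ℝ} (hg : CircleIntegrable g 0 1) :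
    eintegral arcMeasure (fun θ : ℝ => (g (Complex.exp (θ * Complex.I)) : EReal)) =
      (circleAverage g 0 1 : ℝ) := by
  have hc : ∀ θ : ℝ, Complex.exp (θ * Complex.I) = circleMap 0 1 θ := fun θ => by simp [circleMap]
  simp only [hc]
  unfold CircleIntegrable at hg
  rw [intervalIntegrable_iff_integrableOn_Ioc_of_le two_pi_pos.le] at hg
  rw [eintegral_coe]
  · rw [arcMeasure, integral_smul_measure, ENNReal.toReal_ofReal (by positivity),
      circleAverage_def, intervalIntegral.integral_of_le two_pi_pos.le]
  · exact hg.smul_measure ENNReal.ofReal_ne_top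

variable {n : ℕ}

theorem SubmeanOn.isPSH {D : Set (Fin n → ℂ)} {v : (Fin n → ℂ) → ℝ}
    (hb : ∃ C, ∀ z ∈ D, |v z| ≤ C) (hu : UpperSemicontinuousOn v D) (hv : SubmeanOn D v) :
    IsPSH D (fun z => (v z : EReal)) where
  lt_top z _ := EReal.coe_lt_top _
  usc := (continuous_coe_real_ereal.comp_upperSemicontinuousOn hu EReal.coe_strictMono.monotone)
  submean a b hd := by
    have hi : CircleIntegrable (fun w : ℂ => v (a + w • b)) 0 1 :=
      circleIntegrable_slice hb hu fun w hw => hd w (by simpa using hw.le)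
    rw [eintegral_arcMeasure_coe (g := fun w : ℂ => v (a + w • b)) hi]
    exact EReal.coe_le_coe_iff.2 (hv a b hd)

theorem IsPSH.submeanOn {D : Set (Fin n → ℂ)} {v : (Fin n → ℂ) → ℝ}
    (hb : ∃ C, ∀ z ∈ D, |v z| ≤ C) (hu : UpperSemicontinuousOn v D)
    (hv : IsPSH D (fun z => (v z : EReal))) : SubmeanOn D v := by
  intro a b hd
  have hi : CircleIntegrable (fun w : ℂ => v (a + w • b)) 0 1 :=
    circleIntegrable_slice hb hu fun w hw => hd w (by simpa using hw.le)
  have h := hv.submean a b hd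
  rw [eintegral_arcMeasure_coe (g := fun w : ℂ => v (a + w • b)) hi] at h
  exact EReal.coe_le_coe_iff.1 h

theorem coe_neg_one : ((-1 : ℝ) : EReal) = -1 := by simp

/-- The real function `max u (-1)`, for `u ≤ 0`. -/
noncomputable def truncate (u : (Fin n → ℂ) → EReal) (z : Fin n → ℂ) : ℝ := (max (u z) (-1)).toReal

theorem coe_truncate {u : (Fin n → ℂ) → EReal} {z : Fin n → ℂ} (h : u z ≤ 0) :
    (truncate u z : EReal) = max (u z) (-1) := by
  refine EReal.coe_toReal ?_ ?_
  · exact ((max_le h (by simp)).trans_lt EReal.zero_lt_top).ne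
  · exact ((EReal.bot_lt_coe (-1)).trans_le (le_max_right _ _)).ne'

theorem le_truncate {u : (Fin n → ℂ) → EReal} {z : Fin n → ℂ} (h : u z ≤ 0) :
    u z ≤ truncate u z := by
  rw [coe_truncate h]
  exact le_max_left _ _

theorem truncate_mem_Icc {u : (Fin n → ℂ) → EReal} {z : Fin n → ℂ} (h : u z ≤ 0) :
    truncate u z ∈ Icc (-1 : ℝ) 0 := by
  have h1 := coe_truncate h
  constructor
  · rw [← EReal.coe_le_coe_iff, h1]
    exact le_max_right _ _
  · rw [← EReal.coe_le_coe_iff, h1]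
    exact max_le h (by simp)

theorem truncate_lt_iff {u : (Fin n → ℂ) → EReal} {z : Fin n → ℂ} (h : u z ≤ 0) {c : ℝ}
    (hc : -1 < c) : truncate u z < c ↔ u z < c := by
  rw [← EReal.coe_lt_coe_iff, coe_truncate h, max_lt_iff, and_iff_left]
  rw [← coe_neg_one]
  exact EReal.coe_lt_coe_iff.2 hc

theorem abs_truncate_le {D : Set (Fin n → ℂ)} {u : (Fin n → ℂ) → EReal} (h0 : ∀ z ∈ D, u z ≤ 0) :
    ∀ z ∈ D, |truncate u z| ≤ 1 := fun z hz => by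
  have := truncate_mem_Icc (h0 z hz)
  exact abs_le.2 ⟨this.1, this.2.trans zero_le_one⟩

theorem IsPSH.upperSemicontinuousOn_truncate {D : Set (Fin n → ℂ)} {u : (Fin n → ℂ) → EReal}
    (hu : IsPSH D u) (h0 : ∀ z ∈ D, u z ≤ 0) : UpperSemicontinuousOn (truncate u) D := by
  intro z hz y hy
  have hy1 : -1 < y := (truncate_mem_Icc (h0 z hz)).1.trans_lt hy
  filter_upwards [hu.usc z hz y ((truncate_lt_iff (h0 z hz) hy1).1 hy), self_mem_nhdsWithin]
    with x hx hxD
  exact (truncate_lt_iff (h0 x hxD) hy1).2 hx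

theorem IsPSH.submeanOn_truncate {D : Set (Fin n → ℂ)} {u : (Fin n → ℂ) → EReal}
    (hu : IsPSH D u) (h0 : ∀ z ∈ D, u z ≤ 0) : SubmeanOn D (truncate u) := by
  intro a b hd
  have ha : a ∈ D := by simpa using hd 0 (by simp)
  have hi : CircleIntegrable (fun w : ℂ => truncate u (a + w • b)) 0 1 :=
    circleIntegrable_slice ⟨1, abs_truncate_le h0⟩ (hu.upperSemicontinuousOn_truncate h0)
      fun w hw => hd w (by simpa using hw.le)
  have hmem : ∀ θ : ℝ, a + Complex.exp (θ * Complex.I) • b ∈ D := fun θ =>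
    hd _ (Complex.norm_exp_ofReal_mul_I θ).le
  rw [← EReal.coe_le_coe_iff, coe_truncate (h0 a ha)]
  refine max_le ?_ ?_
  · refine (hu.submean a b hd).trans ?_
    rw [← eintegral_arcMeasure_coe (g := fun w : ℂ => truncate u (a + w • b)) hi]
    exact eintegral_mono _ fun θ => le_truncate (h0 _ (hmem θ))
  · have h1 : (-1 : ℝ) ≤ circleAverage (fun w : ℂ => truncate u (a + w • b)) 0 1 := by
      rw [← circleAverage_const (-1 : ℝ) 0 1]
      refine circleAverage_mono (circleIntegrable_const _ _ _) hi fun w hw => ?_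
      exact (truncate_mem_Icc (h0 _ (hd w (by simpa using hw.le)))).1
    rw [← coe_neg_one]
    exact EReal.coe_le_coe_iff.2 h1

end PluriExtremal

/-! ### Approximation in B-regular domains -/

namespace PluriExtremal

open Real Metric

theorem exists_abs_le_of_continuousOn_closure {X : Type*} [PseudoMetricSpace X] [ProperSpace X]
    {D : Set X} (hbd : Bornology.IsBounded D) {u : X → ℝ} (hc : ContinuousOn u (closure D)) :
    ∃ C, ∀ z ∈ D, |u z| ≤ C := by
  obtain ⟨C, hC⟩ := hbd.isCompact_closure.exists_bound_of_continuousOn hc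
  exact ⟨C, fun z hz => hC z (subset_closure hz)⟩

theorem SubmeanOn.sub_const {E : Type*} [NormedAddCommGroup E] [NormedSpace ℂ E] {D : Set E}
    {v : E → ℝ} (hv : SubmeanOn D v) (hb : ∃ C, ∀ z ∈ D, |v z| ≤ C)
    (hu : UpperSemicontinuousOn v D) (c : ℝ) : SubmeanOn D (fun z => v z - c) := by
  intro a b hd
  have hi : CircleIntegrable (fun w : ℂ => v (a + w • b)) 0 1 :=
    circleIntegrable_slice hb hu fun w hw => hd w (by simpa using hw.le)
  rw [circleAverage_fun_sub hi (circleIntegrable_const _ _ _), circleAverage_const]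
  exact sub_le_sub_right (hv a b hd) c

variable {n : ℕ}

theorem IsPSH.isLocPSH {D : Set (Fin n → ℂ)} (hD : IsOpen D) (hbd : Bornology.IsBounded D)
    {u : (Fin n → ℂ) → ℝ} (hc : ContinuousOn u (closure D))
    (hu : IsPSH D (fun z => (u z : EReal))) : IsLocPSH D u := by
  have hb := exists_abs_le_of_continuousOn_closure hbd hc
  have husc := (hc.mono subset_closure).upperSemicontinuousOn
  exact (hu.submeanOn hb husc).isLocPSH hD hb husc

theorem IsBRegular.exists_continuous_approx [Nontrivial (Fin n → ℂ)] {D : Set (Fin n → ℂ)}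
    (hD : IsOpen D) (hbd : Bornology.IsBounded D) (hreg : IsBRegular D) {A : Set (Fin n → ℂ)}
    (hAD : A ⊆ frontier D) {v : (Fin n → ℂ) → ℝ} (hv : IsLocPSH D v)
    (h0 : ∀ z ∈ D, v z ≤ 0) {ε τ : ℝ} (hε : 0 < ε) (hτ : 0 < τ)
    (hA : ∀ z ∈ D, infDist z A < τ → v z ≤ -1 + ε) :
    ∃ w : (Fin n → ℂ) → ℝ, ContinuousOn w (closure D) ∧ SubmeanOn D w ∧ (∀ z ∈ D, w z ≤ 0) ∧
      (∀ ζ ∈ A, w ζ ≤ -1) ∧ ∀ z ∈ D, v z - ε ≤ w z := by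
  -- Equal to -1 + ε on `A` and to 0 at distance at least τ from `A`: a continuous function that
  -- still dominates the boundary values of `v`.
  let φ : (Fin n → ℂ) → ℝ := fun z => min 0 (-1 + ε + infDist z A / τ)
  have hφ : Continuous φ :=
    continuous_const.min (continuous_const.add ((continuous_infDist_pt A).div_const _))
  have hφ0 : ∀ z, φ z ≤ 0 := fun z => min_le_left _ _
  obtain ⟨U, hUc, hUpsh, hUφ⟩ := hreg φ hφ.continuousOn
  obtain ⟨W, hWc, hWpsh, hWφ⟩ := hreg (fun z => -φ z) hφ.neg.continuousOn
  have hU := hUpsh.isLocPSH hD hbd hUc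
  have hW := hWpsh.isLocPSH hD hbd hWc
  have hUt : ∀ ζ ∈ frontier D, ∀ c, φ ζ < c → ∀ᶠ z in 𝓝[D] ζ, U z < c := fun ζ hζ c hc => by
    have h1 : Tendsto U (𝓝[D] ζ) (𝓝 (U ζ)) :=
      (hUc ζ (frontier_subset_closure hζ)).mono subset_closure
    rw [hUφ hζ] at h1
    exact h1.eventually_lt_const hc
  have hWt : ∀ ζ ∈ frontier D, ∀ c, -φ ζ < c → ∀ᶠ z in 𝓝[D] ζ, W z < c := fun ζ hζ c hc => by
    have h1 : Tendsto W (𝓝[D] ζ) (𝓝 (W ζ)) :=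
      (hWc ζ (frontier_subset_closure hζ)).mono subset_closure
    rw [hWφ hζ] at h1
    exact h1.eventually_lt_const hc
  have hvt : ∀ ζ, ∀ᶠ z in 𝓝[D] ζ, v z ≤ φ ζ := fun ζ => by
    by_cases hζ : infDist ζ A < τ
    · filter_upwards [self_mem_nhdsWithin, mem_nhdsWithin_of_mem_nhds
        ((continuous_infDist_pt A).continuousAt.eventually_lt_const hζ)] with z hz hzA
      refine le_min (h0 z hz) ((hA z hz hzA).trans ?_)
      have : 0 ≤ infDist ζ A / τ := div_nonneg infDist_nonneg hτ.le
      linarith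
    · filter_upwards [self_mem_nhdsWithin] with z hz
      have h1 : 1 ≤ infDist ζ A / τ := (one_le_div hτ).2 (not_lt.1 hζ)
      exact le_min (h0 z hz) ((h0 z hz).trans (by linarith))
  have hUW : ∀ z ∈ D, U z + W z ≤ 0 :=
    (hU.add hD hW).nonpos_of_frontier hD hbd fun ζ hζ c hc => by
      filter_upwards [hUt ζ hζ (φ ζ + c / 2) (by linarith), hWt ζ hζ (-φ ζ + c / 2) (by linarith)]
        with z h1 h2
      linarith
  have hvW : ∀ z ∈ D, v z + W z ≤ 0 :=
    (hv.add hD hW).nonpos_of_frontier hD hbd fun ζ hζ c hc => by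
      filter_upwards [hvt ζ, hWt ζ hζ (-φ ζ + c) (by linarith)] with z h1 h2
      linarith
  have hU0 : ∀ z ∈ D, U z ≤ 0 :=
    hU.nonpos_of_frontier hD hbd fun ζ hζ c hc => hUt ζ hζ c ((hφ0 ζ).trans_lt hc)
  -- Since `W` extends -φ, the function -W is a continuous extension of φ that dominates `U` and
  -- `v`. The minimum with 0 keeps the envelope non-positive.
  let G : (Fin n → ℂ) → ℝ := fun z => min (-W z) 0
  have hGc : ContinuousOn G (closure D) := hWc.neg.inf continuousOn_const
  have hGφ : ∀ ζ ∈ frontier D, G ζ = φ ζ := fun ζ hζ => by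
    simp only [G, hWφ hζ, neg_neg]
    exact min_eq_left (hφ0 ζ)
  have hUG : ∀ z ∈ D, U z ≤ G z := fun z hz => le_min (by linarith [hUW z hz]) (hU0 z hz)
  have hvG : ∀ z ∈ D, v z ≤ G z := fun z hz => le_min (by linarith [hvW z hz]) (h0 z hz)
  have hVc : ContinuousOn (envelope D G) (closure D) := continuousOn_envelope hD hbd hUc hGc hUG
    (fun ζ hζ => (hUφ hζ).trans (hGφ ζ hζ).symm) hU
  refine ⟨fun z => envelope D G z - ε, hVc.sub continuousOn_const, ?_, fun z hz => ?_,
    fun ζ hζ => ?_, fun z hz => sub_le_sub_right (hv.le_envelope hvG hz) ε⟩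
  · exact (submeanOn_envelope (hVc.mono subset_closure) hUG hU).sub_const
      (exists_abs_le_of_continuousOn_closure hbd hVc)
      (hVc.mono subset_closure).upperSemicontinuousOn ε
  · have := envelope_le hU hUG hz fun v _ hv => (hv z hz).trans (min_le_right _ _)
    linarith
  · have hζD : ζ ∉ D := fun h => by
      have := (hAD hζ).2
      rw [hD.interior_eq] at this
      exact this h
    have h1 : φ ζ ≤ -1 + ε := by
      refine (min_le_right _ _).trans ?_
      rw [infDist_zero_of_mem hζ]
      simp
    simp only [envelope, if_neg hζD, hGφ ζ (hAD hζ)]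
    linarith

end PluriExtremal

/-! ### Rays are not thin at their end points -/

namespace PluriExtremal

open Real Metric

/-- The principal square root. -/
noncomputable def csqrt (w : ℂ) : ℂ := Complex.exp (Complex.log w / 2)

theorem csqrt_re (w : ℂ) : (csqrt w).re = exp (log ‖w‖ / 2) * cos (w.arg / 2) := by
  have h1 : (Complex.log w / 2).re = log ‖w‖ / 2 := by
    rw [← Complex.log_re, show (2 : ℂ) = ((2 : ℝ) : ℂ) by norm_num, Complex.div_ofReal_re]
  have h2 : (Complex.log w / 2).im = w.arg / 2 := by
    rw [← Complex.log_im, show (2 : ℂ) = ((2 : ℝ) : ℂ) by norm_num, Complex.div_ofReal_im]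
  rw [csqrt, Complex.exp_re, h1, h2]

theorem csqrt_re_nonneg (w : ℂ) : 0 ≤ (csqrt w).re := by
  rw [csqrt_re]
  refine mul_nonneg (exp_pos _).le (cos_nonneg_of_mem_Icc ⟨?_, ?_⟩)
  · linarith [Complex.neg_pi_lt_arg w]
  · linarith [Complex.arg_le_pi w]

theorem csqrt_re_pos {w : ℂ} (h : w ∈ Complex.slitPlane) : 0 < (csqrt w).re := by
  rw [csqrt_re]
  refine mul_pos (exp_pos _) (cos_pos_of_mem_Ioo ⟨?_, ?_⟩)
  · linarith [Complex.neg_pi_lt_arg w]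
  · linarith [lt_of_le_of_ne (Complex.arg_le_pi w) (Complex.mem_slitPlane_iff_arg.1 h).1]

theorem csqrt_sq {σ : ℝ} (hσ : 0 < σ) : csqrt ((σ ^ 2 : ℝ) : ℂ) = σ := by
  rw [csqrt, ← Complex.ofReal_log (by positivity), log_pow]
  rw [show (((2 : ℕ) * log σ : ℝ) : ℂ) / 2 = ((log σ : ℝ) : ℂ) by push_cast; ring,
    ← Complex.ofReal_exp, exp_log hσ]

theorem differentiableOn_csqrt : DifferentiableOn ℂ csqrt Complex.slitPlane := by
  intro w hw
  exact ((Complex.differentiableAt_log hw).div_const 2).cexp.differentiableWithinAt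

theorem norm_csqrt_le {w : ℂ} (hw : w ≠ 0) {R : ℝ} (h : ‖w‖ ≤ R) :
    ‖csqrt w‖ ≤ exp (log R / 2) := by
  have h1 : (Complex.log w / 2).re = log ‖w‖ / 2 := by
    rw [← Complex.log_re, show (2 : ℂ) = ((2 : ℝ) : ℂ) by norm_num, Complex.div_ofReal_re]
  rw [csqrt, Complex.norm_exp, h1]
  have := log_le_log (norm_pos_iff.2 hw) h
  gcongr

/-- A ray is not thin at its end point. -/
theorem IsLocPSH.frequently_lt_ray {Ω : Set ℂ} (hΩ : IsOpen Ω) {f : ℂ → ℝ} (hf : IsLocPSH Ω f)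
    (h0 : (0 : ℂ) ∈ Ω) {c : ℝ} (hc : c < f 0) : ∃ᶠ t : ℝ in 𝓝[>] 0, c < f t := by
  intro hev
  simp only [not_lt] at hev
  obtain ⟨ρ, hρ, hρΩ, hray⟩ : ∃ ρ : ℝ, 0 < ρ ∧ closedBall 0 ρ ⊆ Ω ∧
      ∀ t : ℝ, 0 < t → t ≤ ρ → f t ≤ c := by
    obtain ⟨δ, hδ, h1⟩ := mem_nhdsGT_iff_exists_Ioc_subset.1 hev
    obtain ⟨δ', hδ', h2⟩ := Metric.nhds_basis_closedBall.mem_iff.1 (hΩ.mem_nhds h0)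
    exact ⟨min δ δ', lt_min hδ hδ', (closedBall_subset_closedBall (min_le_right _ _)).trans h2,
      fun t ht htρ => h1 ⟨ht, htρ.trans (min_le_left _ _)⟩⟩
  obtain ⟨M, hM⟩ := hf.bdd
  -- The slack between `c` and `c'` lets the bound on the ray spread to neighbourhoods by upper
  -- semicontinuity.
  obtain ⟨c', hcc', hc'⟩ := exists_between hc
  have hMc : 0 < M - c' := by linarith [le_abs_self (f 0), hM 0 h0]
  have hρmem : (ρ : ℂ) ∈ Ω := hρΩ (by simp [abs_of_pos hρ])
  have hfΩ : ∀ ζ ∈ Ω, f ζ < c' → ∀ᶠ w in 𝓝 ζ, f w < c' := fun ζ hζ h => by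
    have := hf.usc ζ hζ c' h
    rwa [hΩ.nhdsWithin_eq hζ] at this
  obtain ⟨τ, hτ, hball⟩ := Metric.eventually_nhds_iff_ball.1
    (hfΩ ρ hρmem ((hray ρ hρ le_rfl).trans_lt hcc'))
  have hslit : ∀ (s : ℝ) (w : ℂ), (s : ℂ) - w ∉ Complex.slitPlane → ∃ t : ℝ, s ≤ t ∧ w = t := by
    intro s w h
    rw [Complex.mem_slitPlane_iff, not_or, not_lt, not_not] at h
    refine ⟨w.re, by simpa using h.1, Complex.ext (by simp) ?_⟩
    have := h.2
    simp only [Complex.sub_im, Complex.ofReal_im, zero_sub, neg_eq_zero] at this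
    simpa using this
  -- Taking all s in [0, ρ/2] together gives a lower bound `m` for Re √(s - w) that is independent
  -- of s, so s can be chosen after `m`. The ball about ρ removes the point where the slit meets the
  -- circle.
  have hK : IsCompact (Icc (0 : ℝ) (ρ / 2) ×ˢ (sphere (0 : ℂ) ρ \ ball (ρ : ℂ) τ)) :=
    isCompact_Icc.prod ((isCompact_sphere _ _).diff isOpen_ball)
  have hKs : ∀ p ∈ Icc (0 : ℝ) (ρ / 2) ×ˢ (sphere (0 : ℂ) ρ \ ball (ρ : ℂ) τ),
      (p.1 : ℂ) - p.2 ∈ Complex.slitPlane := by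
    rintro ⟨s, w⟩ ⟨hs, hw, hwτ⟩
    by_contra hn
    obtain ⟨t, ht, rfl⟩ := hslit s w hn
    simp only at hs hw ht hwτ
    have ht0 : 0 ≤ t := hs.1.trans ht
    have : t = ρ := by simpa [abs_of_nonneg ht0] using hw
    exact hwτ (by simp [this, hτ])
  obtain ⟨m, hm, hmK⟩ := hK.exists_forall_le' (f := fun p : ℝ × ℂ => (csqrt ((p.1 : ℂ) - p.2)).re)
    (Complex.continuous_re.comp_continuousOn (differentiableOn_csqrt.continuousOn.comp
      (by fun_prop) hKs)) (a := 0) (fun p hp => csqrt_re_pos (hKs p hp))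
  -- The slit will start at s = σ², where √s = σ; the last condition says that the barrier costs
  -- less than f 0 - c' at the origin.
  obtain ⟨σ, hσ, hσ1, hσ2⟩ : ∃ σ : ℝ, 0 < σ ∧ σ ^ 2 < ρ / 2 ∧ (M - c') / m * σ < f 0 - c' := by
    have e1 : ∀ᶠ σ : ℝ in 𝓝[>] 0, σ ^ 2 < ρ / 2 :=
      mem_nhdsWithin_of_mem_nhds ((continuous_pow 2).continuousAt.eventually_lt_const (by simpa using hρ))
    have e2 : ∀ᶠ σ : ℝ in 𝓝[>] 0, (M - c') / m * σ < f 0 - c' :=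
      mem_nhdsWithin_of_mem_nhds ((continuous_const_mul _).continuousAt.eventually_lt_const
        (by simpa using hc'))
    obtain ⟨σ, h2, h3, h1⟩ := (e1.and (e2.and self_mem_nhdsWithin)).exists
    exact ⟨σ, h1, h2, h3⟩
  set s : ℝ := σ ^ 2 with hs
  have hs0 : 0 < s := by positivity
  -- Chosen so that M - k m = c', which brings `f` minus the barrier down to `c'` on the circle away
  -- from ρ.
  let k : ℝ := (M - c') / m
  have hk : 0 < k := div_pos hMc hm
  let Ω' : Set ℂ := ball 0 ρ ∩ (fun w => (s : ℂ) - w) ⁻¹' Complex.slitPlane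
  have hpre : IsOpen ((fun w => (s : ℂ) - w) ⁻¹' Complex.slitPlane) :=
    Complex.isOpen_slitPlane.preimage (by fun_prop)
  have hΩ' : IsOpen Ω' := isOpen_ball.inter hpre
  have hg : DifferentiableOn ℂ (fun w => -(k : ℂ) * csqrt (s - w)) Ω' :=
    (differentiableOn_csqrt.comp (by fun_prop) fun w hw => hw.2).const_mul _
  have hgre : ∀ w, (-(k : ℂ) * csqrt (s - w)).re = -(k * (csqrt (s - w)).re) := fun w => by
    rw [neg_mul, Complex.neg_re, Complex.re_ofReal_mul]
  have hF : IsLocPSH Ω' (fun w => (f w + (-(k : ℂ) * csqrt (s - w)).re) + -c') := by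
    refine ((hf.mono ?_).add hΩ' (isLocPSH_re hΩ' hg ?_)).add hΩ' (isLocPSH_const _ _)
    · exact inter_subset_left.trans (ball_subset_closedBall.trans hρΩ)
    · refine ⟨k * exp (log (s + ρ) / 2), fun w hw => ?_⟩
      rw [norm_mul, norm_neg, Complex.norm_real, norm_of_nonneg hk.le]
      refine mul_le_mul_of_nonneg_left (norm_csqrt_le (Complex.slitPlane_ne_zero hw.2) ?_) hk.le
      refine (norm_sub_le _ _).trans (add_le_add ?_ ?_)
      · rw [Complex.norm_real, norm_of_nonneg hs0.le]
      · exact (mem_ball_zero_iff.1 hw.1).le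
  have hmain := hF.nonpos_of_frontier hΩ' (isBounded_ball.subset inter_subset_left) ?_ 0
    ⟨by simpa using hρ, by simp [Complex.ofReal_mem_slitPlane, hs0]⟩
  · rw [hgre, sub_zero, hs, csqrt_sq hσ, Complex.ofReal_re] at hmain
    linarith
  -- There are three kinds of boundary points. On the slit and on the circle near ρ, f < c' and the
  -- barrier only helps; on the rest of the circle the barrier absorbs the bound `M`.
  · intro ζ hζ ε hε
    simp only [hgre]
    have hζρ : ζ ∈ closedBall (0 : ℂ) ρ :=
      closure_minimal (inter_subset_left.trans ball_subset_closedBall) isClosed_closedBall hζ.1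
    have hζ' : ζ ∉ Ω' := by
      have := hζ.2
      rwa [hΩ'.interior_eq] at this
    have hlow : f ζ < c' → ∀ᶠ w in 𝓝[Ω'] ζ, f w + -(k * (csqrt (s - w)).re) + -c' < ε := by
      intro hlt
      filter_upwards [mem_nhdsWithin_of_mem_nhds (hfΩ ζ (hρΩ hζρ) hlt)] with w hw
      have := mul_nonneg hk.le (csqrt_re_nonneg (s - w))
      linarith
    by_cases hsl : (s : ℂ) - ζ ∈ Complex.slitPlane
    · have hsph : ζ ∈ sphere (0 : ℂ) ρ := by
        by_contra hne
        refine hζ' ⟨?_, hsl⟩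
        rw [mem_ball]
        exact lt_of_le_of_ne hζρ hne
      by_cases hζτ : ζ ∈ ball (ρ : ℂ) τ
      · exact hlow (hball ζ hζτ)
      · have hmζ : m ≤ (csqrt (s - ζ)).re := hmK (s, ζ) ⟨⟨hs0.le, hσ1.le⟩, hsph, hζτ⟩
        have hcont : ContinuousAt (fun w => k * (csqrt ((s : ℂ) - w)).re) ζ := by
          refine continuousAt_const.mul (Complex.continuous_re.continuousAt.comp ?_)
          exact ContinuousAt.comp (f := fun w => (s : ℂ) - w)
            (differentiableOn_csqrt.continuousOn.continuousAt
              (Complex.isOpen_slitPlane.mem_nhds hsl)) (by fun_prop)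
        have hkm : M - c' - ε < k * (csqrt (s - ζ)).re := by
          have h1 := mul_le_mul_of_nonneg_left hmζ hk.le
          have h2 : k * m = M - c' := div_mul_cancel₀ _ hm.ne'
          linarith
        filter_upwards [mem_nhdsWithin_of_mem_nhds (hcont.eventually_const_lt hkm),
          self_mem_nhdsWithin] with w h1 h2
        have := (le_abs_self _).trans (hM w (hρΩ (ball_subset_closedBall h2.1)))
        linarith
    · obtain ⟨t, hst, rfl⟩ := hslit s ζ hsl
      have ht0 : 0 < t := hs0.trans_le hst
      refine hlow ((hray t ht0 ?_).trans_lt hcc')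
      simpa [abs_of_pos ht0] using hζρ

end PluriExtremal

/-! ### Smoothing by a rotation invariant kernel -/

namespace PluriExtremal

open Real Metric

theorem measurable_indicator_of_upperSemicontinuousOn {X : Type*} [TopologicalSpace X]
    [MeasurableSpace X] [OpensMeasurableSpace X] {D : Set X} (hD : IsOpen D) {v : X → ℝ}
    (hv : UpperSemicontinuousOn v D) : Measurable (D.indicator v) := by
  refine measurable_of_Iio fun c => ?_
  obtain ⟨u, hu, he⟩ := upperSemicontinuousOn_iff_preimage_Iio.1 hv c
  have h1 : D.indicator v ⁻¹' Iio c = (D ∩ u) ∪ (Dᶜ ∩ {_x | 0 < c}) := by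
    rw [← he]
    ext x
    by_cases hx : x ∈ D <;> simp [hx]
  rw [h1]
  exact (hD.inter hu).measurableSet.union (hD.measurableSet.compl.inter (MeasurableSet.const _))

variable {n : ℕ}

/-- The normalized tent function of radius `δ`. -/
noncomputable def tent (δ : ℝ) (t : Fin n → ℂ) : ℝ :=
  max 0 (δ - ‖t‖) / ∫ s : Fin n → ℂ, max 0 (δ - ‖s‖)

theorem continuous_max_sub_norm (δ : ℝ) : Continuous fun t : Fin n → ℂ => max 0 (δ - ‖t‖) := by
  fun_prop

theorem hasCompactSupport_max_sub_norm (δ : ℝ) :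
    HasCompactSupport fun t : Fin n → ℂ => max 0 (δ - ‖t‖) := by
  refine HasCompactSupport.intro (isCompact_closedBall 0 δ) fun t ht => ?_
  rw [mem_closedBall_zero_iff, not_le] at ht
  exact max_eq_left (by linarith)

theorem integral_max_sub_norm_pos {δ : ℝ} (hδ : 0 < δ) :
    0 < ∫ s : Fin n → ℂ, max 0 (δ - ‖s‖) := by
  refine (continuous_max_sub_norm δ).integral_pos_of_hasCompactSupport_nonneg_nonzero
    (x := 0) (hasCompactSupport_max_sub_norm δ) (fun _ => le_max_left _ _) ?_
  simp [hδ.le, hδ.ne']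

theorem continuous_tent (δ : ℝ) : Continuous (tent δ : (Fin n → ℂ) → ℝ) :=
  (continuous_max_sub_norm δ).div_const _

theorem hasCompactSupport_tent (δ : ℝ) : HasCompactSupport (tent δ : (Fin n → ℂ) → ℝ) :=
  (hasCompactSupport_max_sub_norm δ).comp_left (g := fun x => x / _) (by simp)

theorem integrable_tent (δ : ℝ) : Integrable (tent δ : (Fin n → ℂ) → ℝ) :=
  (continuous_tent δ).integrable_of_hasCompactSupport (hasCompactSupport_tent δ)

theorem tent_nonneg {δ : ℝ} (hδ : 0 < δ) (t : Fin n → ℂ) : 0 ≤ tent δ t :=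
  div_nonneg (le_max_left _ _) (integral_max_sub_norm_pos hδ).le

theorem tent_eq_zero {δ : ℝ} {t : Fin n → ℂ} (h : δ < ‖t‖) : tent δ t = 0 := by
  rw [tent, max_eq_left (by linarith), zero_div]

theorem integral_tent {δ : ℝ} (hδ : 0 < δ) : ∫ t : Fin n → ℂ, tent δ t = 1 := by
  unfold tent
  rw [integral_div]
  exact div_self (integral_max_sub_norm_pos hδ).ne'

theorem tent_smul (δ : ℝ) {w : ℂ} (hw : ‖w‖ = 1) (t : Fin n → ℂ) : tent δ (w • t) = tent δ t := by
  rw [tent, tent, norm_smul, hw, one_mul]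

/-- Multiplication by `w` rotates every coordinate, so it preserves the product measure. -/
theorem integral_comp_smul_of_norm_one {w : ℂ} (hw : ‖w‖ = 1) (f : (Fin n → ℂ) → ℝ) :
    ∫ t, f (w • t) = ∫ t, f t := by
  have h1 : MeasurePreserving (fun x : ℂ => w * x) :=
    (rotation (⟨w, mem_sphere_zero_iff_norm.2 hw⟩ : Circle)).measurePreserving
  have h2 : MeasurePreserving (fun t : Fin n → ℂ => w • t) := volume_preserving_pi fun _ => h1
  have hw0 : w ≠ 0 := norm_ne_zero_iff.1 (by rw [hw]; exact one_ne_zero)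
  exact h2.integral_comp (Homeomorph.smulOfNeZero w hw0).measurableEmbedding f

theorem integral_mul_circleAverage {k : (Fin n → ℂ) → ℝ} (hk : Integrable k)
    {F : ℂ → (Fin n → ℂ) → ℝ} (hF : Measurable (Function.uncurry F)) {C : ℝ}
    (hC : ∀ w t, |F w t| ≤ C) :
    Integrable (fun t => k t * circleAverage (fun w => F w t) 0 1) ∧
      ∫ t, k t * circleAverage (fun w => F w t) 0 1 =
        circleAverage (fun w => ∫ t, k t * F w t) 0 1 := by
  have hint : Integrable (Function.uncurry fun (t : Fin n → ℂ) (θ : ℝ) => k t * F (circleMap 0 1 θ) t)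
      (volume.prod (volume.restrict (Ioc 0 (2 * π)))) := by
    have : IsFiniteMeasure (volume.restrict (Ioc 0 (2 * π))) := ⟨by simp [ENNReal.mul_lt_top_iff]⟩
    refine (hk.comp_fst (volume.restrict (Ioc 0 (2 * π)))).mul_bdd (c := C)
      (g := fun p : (Fin n → ℂ) × ℝ => F (circleMap 0 1 p.2) p.1)
      ?_ (Eventually.of_forall fun p => hC _ _)
    refine (hF.comp (Measurable.prodMk ?_ measurable_fst)).aestronglyMeasurable
    exact (continuous_circleMap 0 1).measurable.comp measurable_snd
  simp only [circleAverage_def, intervalIntegral.integral_of_le two_pi_pos.le, smul_eq_mul]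
  have hpt : ∀ t, k t * ((2 * π)⁻¹ * ∫ θ in Ioc 0 (2 * π), F (circleMap 0 1 θ) t) =
      (2 * π)⁻¹ * ∫ θ in Ioc 0 (2 * π), k t * F (circleMap 0 1 θ) t := fun t => by
    rw [integral_const_mul]
    ring
  simp only [hpt]
  refine ⟨hint.integral_prod_left.const_mul _, ?_⟩
  rw [← integral_integral_swap hint, ← integral_const_mul]

/-- The mean of the extension of `v` by zero against the tent function of radius `δ`. -/
noncomputable def smoothing (D : Set (Fin n → ℂ)) (v : (Fin n → ℂ) → ℝ) (δ : ℝ)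
    (z : Fin n → ℂ) : ℝ :=
  ∫ t, tent δ t * D.indicator v (z - t)

section

variable {D : Set (Fin n → ℂ)} {v : (Fin n → ℂ) → ℝ} {C δ : ℝ}

theorem abs_indicator_le (hC0 : 0 ≤ C) (hC : ∀ z ∈ D, |v z| ≤ C) (z : Fin n → ℂ) :
    |D.indicator v z| ≤ C := by
  by_cases hz : z ∈ D
  · simpa [hz] using hC z hz
  · simpa [hz] using hC0

theorem integrable_tent_mul {g : (Fin n → ℂ) → ℝ} (hg : Measurable g) (hC : ∀ z, |g z| ≤ C)
    (δ : ℝ) : Integrable fun t => tent δ t * g t :=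
  (integrable_tent δ).mul_bdd (c := C) hg.aestronglyMeasurable (Eventually.of_forall hC)

theorem continuous_smoothing (hD : IsOpen D) (hv : UpperSemicontinuousOn v D) (hC0 : 0 ≤ C)
    (hC : ∀ z ∈ D, |v z| ≤ C) (δ : ℝ) : Continuous (smoothing D v δ) := by
  have hm := measurable_indicator_of_upperSemicontinuousOn hD hv
  have hloc : LocallyIntegrable (D.indicator v) := by
    refine (locallyIntegrable_const C).mono hm.aestronglyMeasurable (Eventually.of_forall fun z => ?_)
    simpa [abs_of_nonneg hC0] using abs_indicator_le hC0 hC z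
  exact (hasCompactSupport_tent δ).continuous_convolution_left (ContinuousLinearMap.lsmul ℝ ℝ)
    (continuous_tent δ) hloc

theorem smoothing_le (hD : IsOpen D) (hv : UpperSemicontinuousOn v D) (hC0 : 0 ≤ C)
    (hC : ∀ z ∈ D, |v z| ≤ C) (hδ : 0 < δ) {z : Fin n → ℂ} {c : ℝ}
    (hz : ∀ t, ‖t‖ ≤ δ → z - t ∈ D ∧ v (z - t) ≤ c) : smoothing D v δ z ≤ c := by
  have hm := measurable_indicator_of_upperSemicontinuousOn hD hv
  have h1 : ∫ t : Fin n → ℂ, tent δ t * c = c := by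
    rw [integral_mul_const, integral_tent hδ, one_mul]
  rw [← h1]
  refine integral_mono (integrable_tent_mul (hm.comp (measurable_const.sub measurable_id))
    (fun t => abs_indicator_le hC0 hC _) δ) ((integrable_tent δ).mul_const c) fun t => ?_
  by_cases ht : ‖t‖ ≤ δ
  · refine mul_le_mul_of_nonneg_left ?_ (tent_nonneg hδ t)
    simpa [(hz t ht).1] using (hz t ht).2
  · simp [tent_eq_zero (not_le.1 ht)]

/-- The kernel and Lebesgue measure are invariant under t ↦ w t with |w| = 1, so the smoothing may
be averaged over these rotations. By Fubini it becomes an average of circle means of `v` about `z`,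
each at least `v z`. -/
theorem le_smoothing (hD : IsOpen D) (hv : UpperSemicontinuousOn v D) (hsub : SubmeanOn D v)
    (hC0 : 0 ≤ C) (hC : ∀ z ∈ D, |v z| ≤ C) (hδ : 0 < δ) {z : Fin n → ℂ}
    (hz : ∀ t, ‖t‖ ≤ δ → z - t ∈ D) : v z ≤ smoothing D v δ z := by
  have hm := measurable_indicator_of_upperSemicontinuousOn hD hv
  have hrot : ∀ w ∈ sphere (0 : ℂ) |1|,
      ∫ t, tent δ t * D.indicator v (z - w • t) = smoothing D v δ z := fun w hw => by
    have hw1 : ‖w‖ = 1 := by simpa using hw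
    rw [smoothing, ← integral_comp_smul_of_norm_one hw1 fun t => tent δ t * D.indicator v (z - t)]
    simp only [tent_smul δ hw1]
  have hF : Measurable (Function.uncurry fun (w : ℂ) (t : Fin n → ℂ) => D.indicator v (z - w • t)) := by
    refine hm.comp (Continuous.measurable ?_)
    fun_prop
  have hFC : ∀ (w : ℂ) (t : Fin n → ℂ), |D.indicator v (z - w • t)| ≤ C :=
    fun w t => abs_indicator_le hC0 hC _
  obtain ⟨hint, hkey⟩ := integral_mul_circleAverage (integrable_tent δ) hF hFC
  rw [circleAverage_const_on_circle hrot] at hkey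
  rw [← hkey]
  have h1 : ∫ t : Fin n → ℂ, tent δ t * v z = v z := by
    rw [integral_mul_const, integral_tent hδ, one_mul]
  rw [← h1]
  refine integral_mono ((integrable_tent δ).mul_const _) hint fun t => ?_
  by_cases ht : ‖t‖ ≤ δ
  · have hmem : ∀ w : ℂ, ‖w‖ ≤ 1 → z + w • -t ∈ D := fun w hw => by
      rw [smul_neg, ← sub_eq_add_neg]
      refine hz _ ?_
      rw [norm_smul]
      exact (mul_le_of_le_one_left (norm_nonneg t) hw).trans ht
    refine mul_le_mul_of_nonneg_left ((hsub z (-t) hmem).trans_eq ?_) (tent_nonneg hδ t)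
    refine circleAverage_congr_sphere fun w hw => ?_
    have h2 := hmem w (by simpa using (mem_sphere_zero_iff_norm.1 hw).le)
    rw [smul_neg, ← sub_eq_add_neg] at h2
    simp [h2, ← sub_eq_add_neg]
  · simp [tent_eq_zero (not_le.1 ht)]

/-- A weighted mean of translates of `v`, each satisfying the inequality on the given disc; Fubini
exchanges the two means. -/
theorem submean_smoothing (hD : IsOpen D) (hv : UpperSemicontinuousOn v D) (hsub : SubmeanOn D v)
    (hC0 : 0 ≤ C) (hC : ∀ z ∈ D, |v z| ≤ C) (hδ : 0 < δ) {a b : Fin n → ℂ}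
    (hab : ∀ w : ℂ, ‖w‖ ≤ 1 → ∀ t, ‖t‖ ≤ δ → a + w • b - t ∈ D) :
    smoothing D v δ a ≤ circleAverage (fun w : ℂ => smoothing D v δ (a + w • b)) 0 1 := by
  have hm := measurable_indicator_of_upperSemicontinuousOn hD hv
  have hF : Measurable (Function.uncurry
      fun (w : ℂ) (t : Fin n → ℂ) => D.indicator v (a + w • b - t)) := by
    refine hm.comp (Continuous.measurable ?_)
    fun_prop
  have hFC : ∀ (w : ℂ) (t : Fin n → ℂ), |D.indicator v (a + w • b - t)| ≤ C :=
    fun w t => abs_indicator_le hC0 hC _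
  obtain ⟨hint, hkey⟩ := integral_mul_circleAverage (integrable_tent δ) hF hFC
  unfold smoothing
  rw [← hkey]
  refine integral_mono (integrable_tent_mul (hm.comp (measurable_const.sub measurable_id))
    (fun t => abs_indicator_le hC0 hC _) δ) hint fun t => ?_
  by_cases ht : ‖t‖ ≤ δ
  · have hmem : ∀ w : ℂ, ‖w‖ ≤ 1 → a - t + w • b ∈ D := fun w hw => by
      rw [sub_add_eq_add_sub]
      exact hab w hw t ht
    have ha : a - t ∈ D := by simpa using hmem 0 (by simp)
    simp only [ha, indicator_of_mem]
    refine mul_le_mul_of_nonneg_left ((hsub (a - t) b hmem).trans_eq ?_) (tent_nonneg hδ t)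
    refine circleAverage_congr_sphere fun w hw => ?_
    have h2 := hab w (by simpa using (mem_sphere_zero_iff_norm.1 hw).le) t ht
    simp [h2, sub_add_eq_add_sub]
  · simp [tent_eq_zero (not_le.1 ht)]

end

end PluriExtremal

/-! ### Star shaped domains, polydiscs and the final reduction -/

namespace PluriExtremal

open Real Metric

variable {n : ℕ}

theorem exists_continuous_approx_of_strongly_star_shaped {D : Set (Fin n → ℂ)}
    (hD : IsOpen D) (hbd : Bornology.IsBounded D) {c : Fin n → ℂ}
    (hstar : ∀ r : ℝ, 0 < r → r < 1 → ∀ z ∈ closure D, c + r • (z - c) ∈ D)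
    {A : Set (Fin n → ℂ)} (hAD : A ⊆ closure D) {v : (Fin n → ℂ) → ℝ}
    (husc : UpperSemicontinuousOn v D) (hsub : SubmeanOn D v) {C : ℝ} (hC0 : 0 ≤ C)
    (hC : ∀ z ∈ D, |v z| ≤ C) (h0 : ∀ z ∈ D, v z ≤ 0) {ε τ : ℝ} (hε : 0 < ε) (hτ : 0 < τ)
    (hA : ∀ z ∈ D, infDist z A < τ → v z ≤ -1 + ε) {z₀ : Fin n → ℂ} (hz₀ : z₀ ∈ D) :
    ∃ w : (Fin n → ℂ) → ℝ, ContinuousOn w (closure D) ∧ SubmeanOn D w ∧ (∀ z ∈ D, w z ≤ 0) ∧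
      (∀ ζ ∈ A, w ζ ≤ -1) ∧ v z₀ - 2 * ε ≤ w z₀ := by
  obtain ⟨R, hR⟩ := hbd.isCompact_closure.exists_bound_of_continuousOn
    (f := fun z => z - c) (by fun_prop)
  have hpsh : IsLocPSH D v := hsub.isLocPSH hD ⟨C, hC⟩ husc
  have hlineo : IsOpen ((fun w : ℂ => z₀ + w • (c - z₀)) ⁻¹' D) := hD.preimage (by fun_prop)
  -- In the complex line through `z₀` and `c`, the contracted point is the parameter t > 0 on a ray
  -- issuing from `z₀`, so arbitrarily small t lose less than ε.
  have hfreq := (hpsh.comp_line z₀ (c - z₀)).frequently_lt_ray hlineo (by simpa using hz₀)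
    (c := v z₀ - ε) (by simpa using hε)
  have hsmall : ∀ᶠ t : ℝ in 𝓝[>] 0, t * R < τ / 2 := mem_nhdsWithin_of_mem_nhds
    ((continuous_mul_const R).continuousAt.eventually_lt_const (by simpa using hτ))
  obtain ⟨t, hvt, htR, ht0, ht1⟩ :=
    (hfreq.and_eventually (hsmall.and (Ioo_mem_nhdsGT one_pos))).exists
  let T : (Fin n → ℂ) → (Fin n → ℂ) := fun z => c + (1 - t) • (z - c)
  have hTc : Continuous T := by fun_prop
  have hTD : ∀ z ∈ closure D, T z ∈ D := hstar (1 - t) (by linarith) (by linarith)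
  obtain ⟨δ₁, hδ₁, hsubD⟩ := (hbd.isCompact_closure.image hTc).exists_cthickening_subset_open hD
    (image_subset_iff.2 hTD)
  -- The contraction moves points of `A` by less than τ/2 and the convolution by at most τ/2, so
  -- only values of `v` within τ of `A` enter.
  let δ := min δ₁ (τ / 2)
  have hδ : 0 < δ := lt_min hδ₁ (half_pos hτ)
  have hball : ∀ z ∈ closure D, ∀ s, ‖s‖ ≤ δ → T z - s ∈ D := fun z hz s hs => by
    refine hsubD (mem_cthickening_of_dist_le _ (T z) _ _ (mem_image_of_mem T hz) ?_)
    rw [dist_eq_norm, sub_sub_cancel_left, norm_neg]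
    exact hs.trans (min_le_left _ _)
  have hcont : Continuous fun z => smoothing D v δ (T z) :=
    (continuous_smoothing hD husc hC0 hC δ).comp hTc
  refine ⟨fun z => smoothing D v δ (T z) - ε, (hcont.sub continuous_const).continuousOn, ?_,
    fun z hz => ?_, fun ζ hζ => ?_, ?_⟩
  · refine SubmeanOn.sub_const (v := fun z => smoothing D v δ (T z)) ?_
      (exists_abs_le_of_continuousOn_closure hbd hcont.continuousOn)
      hcont.continuousOn.upperSemicontinuousOn ε
    intro a b hd
    have hTab : ∀ w : ℂ, T (a + w • b) = T a + w • ((1 - t) • b) := fun w => by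
      simp only [T, smul_sub, smul_add, smul_comm w (1 - t) b]
      abel
    simp only [hTab]
    refine submean_smoothing hD husc hsub hC0 hC hδ fun w hw s hs => ?_
    rw [← hTab]
    exact hball _ (subset_closure (hd w hw)) s hs
  · have : smoothing D v δ (T z) ≤ 0 := smoothing_le hD husc hC0 hC hδ fun s hs =>
      ⟨hball z (subset_closure hz) s hs, h0 _ (hball z (subset_closure hz) s hs)⟩
    linarith
  · have : smoothing D v δ (T ζ) ≤ -1 + ε := smoothing_le hD husc hC0 hC hδ fun s hs => by
      have hmem := hball ζ (hAD hζ) s hs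
      refine ⟨hmem, hA _ hmem ((infDist_le_dist_of_mem hζ).trans_lt ?_)⟩
      have e : T ζ - s - ζ = -(t • (ζ - c)) - s := by
        simp only [T, sub_smul, one_smul]
        abel
      rw [dist_eq_norm, e]
      refine (norm_sub_le _ _).trans_lt ?_
      rw [norm_neg, norm_smul, norm_of_nonneg ht0.le]
      have h1 := mul_le_mul_of_nonneg_left (hR ζ (hAD hζ)) ht0.le
      have h2 := hs.trans (min_le_right _ _)
      linarith
    linarith
  · have h1 : T z₀ = z₀ + (t : ℂ) • (c - z₀) := by
      rw [Complex.coe_smul]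
      simp only [T, sub_smul, one_smul, smul_sub]
      abel
    have h2 := le_smoothing hD husc hsub hC0 hC hδ (hball z₀ (subset_closure hz₀))
    rw [← h1] at hvt
    linarith

theorem IsPolydisc.exists_center {D : Set (Fin n → ℂ)} (h : IsPolydisc D) :
    ∃ c : Fin n → ℂ, ∀ r : ℝ, 0 < r → r < 1 → ∀ z ∈ closure D, c + r • (z - c) ∈ D := by
  obtain ⟨c, ρ, hρ, rfl⟩ := h
  refine ⟨c, fun r hr0 hr1 z hz i => ?_⟩
  have hcl : IsClosed {z : Fin n → ℂ | ∀ i, ‖z i - c i‖ ≤ ρ i} := by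
    simp only [ofPred_forall]
    exact isClosed_iInter fun i => isClosed_le (by fun_prop) continuous_const
  have hzi : ‖z i - c i‖ ≤ ρ i := closure_minimal (fun z hz i => (hz i).le) hcl hz i
  simp only [Pi.add_apply, Pi.smul_apply, Pi.sub_apply, add_sub_cancel_left, norm_smul,
    norm_of_nonneg hr0.le]
  exact (mul_le_mul_of_nonneg_left hzi hr0.le).trans_lt (mul_lt_of_lt_one_left (hρ i) hr1)

theorem omegaC_le_omega {D A : Set (Fin n → ℂ)} (hAD : A ⊆ closure D) (z : Fin n → ℂ) :
    omegaC z A D ≤ omega z A D := by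
  refine sSup_le_sSup ?_
  rintro t ⟨u, hu, h0, hc, hA, rfl⟩
  refine ⟨fun w => (u w : EReal), hu, fun w hw => EReal.coe_nonpos.2 (h0 w hw), fun ζ hζ => ?_, rfl⟩
  have : (𝓝[D] ζ).NeBot := mem_closure_iff_nhdsWithin_neBot.1 (hAD hζ)
  have h1 : Tendsto (fun w => (u w : EReal)) (𝓝[D] ζ) (𝓝 (u ζ : EReal)) :=
    (continuous_coe_real_ereal.tendsto _).comp ((hc ζ (hAD hζ)).mono subset_closure)
  rw [upperReg, h1.limsup_eq, ← coe_neg_one]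
  exact EReal.coe_le_coe_iff.2 (hA ζ hζ)

/-- The constant 0 is extremal. This case stands apart because `infDist` to the empty set is 0, so
it does not describe neighbourhoods of `A`. -/
theorem omega_empty (z : Fin n → ℂ) {D : Set (Fin n → ℂ)} (hz : z ∈ D) :
    omega z ∅ D = omegaC z ∅ D := by
  refine le_antisymm ?_ (omegaC_le_omega (empty_subset _) z)
  have h1 : omega z ∅ D ≤ 0 := by
    refine sSup_le ?_
    rintro t ⟨u, -, h0, -, rfl⟩
    exact h0 z hz
  refine h1.trans (le_sSup ⟨fun _ => 0, ?_, by simp, continuousOn_const, by simp, by simp⟩)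
  refine SubmeanOn.isPSH ⟨0, by simp⟩ continuousOn_const.upperSemicontinuousOn fun a b _ => ?_
  simp [circleAverage_const]

/-- A function with upper boundary values at most `-1` on a compact set is nearly at most `-1` in
the points of `D` near that set. -/
theorem exists_truncate_le_near {D A : Set (Fin n → ℂ)} (hA : IsCompact A) (hne : A.Nonempty)
    {u : (Fin n → ℂ) → EReal} (h0 : ∀ z ∈ D, u z ≤ 0) (hu : ∀ ζ ∈ A, upperReg D u ζ ≤ -1)
    {ε : ℝ} (hε : 0 < ε) :
    ∃ τ > 0, ∀ z ∈ D, infDist z A < τ → truncate u z ≤ -1 + ε := by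
  have hε1 : -1 < -1 + ε := by linarith
  have hsub : A ⊆ interior {z | z ∈ D → truncate u z ≤ -1 + ε} := fun ζ hζ => by
    rw [mem_interior_iff_mem_nhds]
    have h1 : limsup u (𝓝[D] ζ) < ((-1 + ε : ℝ) : EReal) := (hu ζ hζ).trans_lt (by
      rw [← coe_neg_one]
      exact EReal.coe_lt_coe_iff.2 hε1)
    filter_upwards [eventually_nhdsWithin_iff.1 (eventually_lt_of_limsup_lt h1)] with z hz hzD
    exact ((truncate_lt_iff (h0 z hzD) hε1).2 (hz hzD)).le
  obtain ⟨τ, hτ, h⟩ := hA.exists_thickening_subset_open isOpen_interior hsub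
  exact ⟨τ, hτ, fun z hz hzA =>
    interior_subset (h ((mem_thickening_iff_infDist_lt hne).2 hzA)) hz⟩

theorem omega_le_omegaC_of_approx {D A : Set (Fin n → ℂ)} (hbd : Bornology.IsBounded D)
    (hA : IsCompact A) (hne : A.Nonempty) {z : Fin n → ℂ} (hz : z ∈ D)
    (h : ∀ v : (Fin n → ℂ) → ℝ, UpperSemicontinuousOn v D → SubmeanOn D v →
      (∀ w ∈ D, |v w| ≤ 1) → (∀ w ∈ D, v w ≤ 0) → ∀ ε > 0, ∀ τ > 0,
      (∀ w ∈ D, infDist w A < τ → v w ≤ -1 + ε) →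
      ∃ w : (Fin n → ℂ) → ℝ, ContinuousOn w (closure D) ∧ SubmeanOn D w ∧ (∀ z ∈ D, w z ≤ 0) ∧
        (∀ ζ ∈ A, w ζ ≤ -1) ∧ v z - 2 * ε ≤ w z) :
    omega z A D ≤ omegaC z A D := by
  refine sSup_le ?_
  rintro t ⟨u, hu, h0, huA, rfl⟩
  refine (le_truncate (h0 z hz)).trans (EReal.ge_of_forall_gt_iff_ge.1 fun x hx => ?_)
  -- With this ε the permitted loss 2ε leads exactly down to `x`.
  have hε : 0 < (truncate u z - x) / 2 := by linarith [EReal.coe_lt_coe_iff.1 hx]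
  obtain ⟨τ, hτ, hnear⟩ := exists_truncate_le_near hA hne h0 huA hε
  obtain ⟨w, hwc, hws, hw0, hwA, hw⟩ := h (truncate u) (hu.upperSemicontinuousOn_truncate h0)
    (hu.submeanOn_truncate h0) (abs_truncate_le h0) (fun z hz => (truncate_mem_Icc (h0 z hz)).2)
    _ hε τ hτ hnear
  refine (EReal.coe_le_coe_iff.2 (by linarith : x ≤ w z)).trans
    (le_sSup ⟨w, hws.isPSH (exists_abs_le_of_continuousOn_closure hbd hwc)
      (hwc.mono subset_closure).upperSemicontinuousOn, hw0, hwc, hwA, rfl⟩)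

end PluriExtremal

theorem mainTheorem5 {n : ℕ} (D : Set (Fin n → ℂ))
    (hD_open : IsOpen D) (hD_conn : IsConnected D) (hD_bdd : Bornology.IsBounded D)
    (hD : PluriExtremal.IsBRegular D ∨ PluriExtremal.IsStronglyStarShaped D ∨
      PluriExtremal.IsPolydisc D)
    (A : Set (Fin n → ℂ)) (hA_sub : A ⊆ frontier D) (hA : IsCompact A) :
    ∀ z ∈ D, PluriExtremal.omega z A D = PluriExtremal.omegaC z A D := by
  intro z hz
  obtain rfl | hne := A.eq_empty_or_nonempty
  · exact PluriExtremal.omega_empty z hz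
  have hA_cl : A ⊆ closure D := hA_sub.trans frontier_subset_closure
  refine le_antisymm ?_ (PluriExtremal.omegaC_le_omega hA_cl z)
  refine PluriExtremal.omega_le_omegaC_of_approx hD_bdd hA hne hz
    fun v husc hsub hv1 hv0 ε hε τ hτ hvA => ?_
  rcases hD with hreg | hstar
  -- The maximum principle needs a complex direction. For n = 0 the domain is the whole space, whose
  -- frontier is empty, contrary to `A` being non-empty.
  · have : Nontrivial (Fin n → ℂ) := by
      by_contra hn
      have := not_nontrivial_iff_subsingleton.1 hn
      obtain ⟨ζ, hζ⟩ := hne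
      have h1 := hA_sub hζ
      rw [Subsingleton.eq_univ_of_nonempty hD_conn.nonempty, frontier_univ] at h1
      exact h1
    obtain ⟨w, hwc, hws, hw0, hwA, hw⟩ := hreg.exists_continuous_approx hD_open hD_bdd hA_sub
      (hsub.isLocPSH hD_open ⟨1, hv1⟩ husc) hv0 hε hτ hvA
    exact ⟨w, hwc, hws, hw0, hwA, by linarith [hw z hz]⟩
  · obtain ⟨c, hc⟩ : ∃ c : Fin n → ℂ,
        ∀ r : ℝ, 0 < r → r < 1 → ∀ z ∈ closure D, c + r • (z - c) ∈ D := by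
      rcases hstar with hstar | hpoly
      · exact ⟨0, fun r h0 h1 z hz => by simpa using hstar r h0 h1 z hz⟩
      · exact hpoly.exists_center
    exact PluriExtremal.exists_continuous_approx_of_strongly_star_shaped hD_open hD_bdd hc hA_cl
      husc hsub zero_le_one hv1 hv0 hε hτ hvA hz
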